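/- **Setting.** Let $K$ be a field of characteristic $0$ (e.g. $\mathbb R$ or $\mathbb C$), $\delta,\tilde\delta\in K$ with $\tilde\delta\neq0$. For dimensions $h,\tilde h$ and central charge $c$ let $$\mathcal F(h,\tilde h,c|z)=\sum_{n\ge0}F_n z^n,\qquad F_n=\sum_{|Y|=|Y'|=n}\gamma_Y\,(G_n^{-1})_{YY'}\,\gamma_{Y'},$$ be the Virasoro conformal block with four equal external dimensions $h$ and intermediate dimension $\tilde h$: $Y=(l_1\ge\dots\ge l_s)$ runs over partitions of $n$, $G_n$ is the Gram matrix of the Verma module of weight $\tilde h$ and central charge $c$ at level $n$ in the basis $L_{-l_1}\cdots L_{-l_s}|\tilde h\rangle$, and $\gamma_Y=\prod_i(\tilde h+l_ih-h+\sum_{j>i}l_j)$. For rational $\alpha>0$, $\alpha\ne1$, put $h=\delta c^\alpha$, $\tilde h=\tilde\delta c^\alpha$ and expand $f^{(\alpha)}=\log\mathcal F$, a power series in $z$, in (fractional) powers of $c$ near $c=\infty$, $f^{(\alpha)}=\sum_a f^{(\alpha)}_a c^a$, with $f^{(\alpha)}_a=f^{(\alpha)}_a(\delta,\tilde\delta|z)$.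 The principal part $\mathrm{Prin}\,f^{(\alpha)}$ consists of the terms with $a\ge0$. The points $\tilde\alpha_M=\frac{M}{M+1}$ and $\overset{\approx}{\alpha}_N=\frac{N+1}{N}$ ($M,N\ge1$) are called exceptional, all other positive rationals $\ne1$ regular. All equalities below are modulo $O(z^6)$. **Proposition.** The Gram matrices at levels $n\le5$ are invertible, so that $f^{(\alpha)}$ is well defined up to $O(z^6)$, and: 1. There is $f_0^{(-)}$ (the universal coefficient) with $f_0^{(\beta)}=f_0^{(-)}$ for every regular rational $\beta\in(0,1)$. For every $M\ge2$ and every rational $\alpha\in\big(\frac{M-1}{M},\frac{M}{M+1}\big]$, the coefficient of the term of minimal non-zero degree in $\mathrm{Prin}\,f^{(\alpha)}$ is $$f^{(\alpha)}_{M\alpha-(M-1)}=f_0^{(\tilde\alpha_{M-1})}-f_0^{(-)},\qquad \tilde\alpha_{M-1}=\tfrac{M-1}{M}.$$ Consequently, for every $M\ge1$, every rational $\alpha\in\big(\frac{M-1}{M},\frac{M}{M+1}\big]$ and every rational $\alpha_1\in(0,\frac12)$, $$\mathrm{Prin}\,f^{(\alpha)}=f^{(\alpha_1)}_{\alpha_1}c^\alpha+\sum_{m=2}^{M}\big(f_0^{(\tilde\alpha_{m-1})}-f_0^{(-)}\big)c^{m\alpha-(m-1)}+f_0^{(\alpha)}.$$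 2. There is $f_0^{(+)}$ with $f_0^{(\beta)}=f_0^{(+)}$ for every regular rational $\beta>1$. For every $N\ge2$ and every rational $\alpha\in\big[\frac{N+1}{N},\frac{N}{N-1}\big)$, the coefficient of the term of minimal non-zero degree in $\mathrm{Prin}\,f^{(\alpha)}$ is $$f^{(\alpha)}_{N-(N-1)\alpha}=f_0^{(\overset{\approx}{\alpha}_{N-1})}-f_0^{(+)},\qquad \overset{\approx}{\alpha}_{N-1}=\tfrac{N}{N-1}.$$ Consequently, for every $N\ge1$, every rational $\alpha\in\big[\frac{N+1}{N},\frac{N}{N-1}\big)$ (for $N=1$: $\alpha\ge2$) and every rational $\alpha_1>2$, $$\mathrm{Prin}\,f^{(\alpha)}=f^{(\alpha_1)}_{\alpha_1}c^\alpha+f^{(\alpha_1)}_1c+\sum_{n=2}^{N}\big(f_0^{(\overset{\approx}{\alpha}_{n-1})}-f_0^{(+)}\big)c^{n-(n-1)\alpha}+f_0^{(\alpha)}.$$ -/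

import Mathlib

open scoped PowerSeries Polynomial

noncomputable section

/-! ### The Virasoro conformal block

A word `[l₁, …, lₛ]` of positive integers stands for the descendant state
`L_{-l₁} ⋯ L_{-lₛ} |ht⟩` of the highest-weight state `|ht⟩` (`L_0 |ht⟩ = ht |ht⟩`, `L_n |ht⟩ = 0`
for `n > 0`), and a finitely supported function on words for a linear combination of descendants. -/

section Block

variable {L : Type*} [Field L]

/-- The state `L_n L_{-l₁} ⋯ L_{-lₛ} |ht⟩`. For `n ≥ 0` the operator `L_n` is moved to the right
with `[L_m, L_n] = (m - n) L_{m+n} + (c / 12) (m³ - m) δ_{m+n,0}`. -/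
def virAct (c ht : L) : List ℕ → ℤ → (List ℕ →₀ L)
  | [], n =>
      if n < 0 then Finsupp.single [n.natAbs] 1
      else if n = 0 then Finsupp.single [] ht
      else 0
  | l :: w, n =>
      if n < 0 then Finsupp.single (n.natAbs :: l :: w) 1
      else
        Finsupp.mapDomain (List.cons l) (virAct c ht w n)
          + ((n : L) + (l : L)) • virAct c ht w (n - l)
          + (if n = (l : ℤ) then Finsupp.single w (c / 12 * ((n : L) ^ 3 - (n : L))) else 0)

/-- The matrix element `⟨ht| L_{kᵣ} ⋯ L_{k₁} |v⟩` for the word `[k₁, …, kᵣ]`, with `⟨ht|ht⟩ = 1` and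
`⟨ht| L_{-n} = 0` for `n > 0`. -/
def matrixElement (c ht : L) : List ℕ → (List ℕ →₀ L) → L
  | [], v => v []
  | k :: ks, v =>
      matrixElement c ht ks (Finsupp.linearCombination L (fun w => virAct c ht w (k : ℤ)) v)

/-- The three-point matrix element `⟨h| O_h(1) L_{-l₁} ⋯ L_{-lₛ} |ht⟩ / ⟨h| O_h(1) |ht⟩` for two
primary operators of the same dimension `h`, which is
`∏ᵢ (ht + lᵢ h - h + l_{i+1} + ⋯ + lₛ)`. -/
def virVertex (h ht : L) : List ℕ → L
  | [] => 1
  | l :: w => (ht + (l : L) * h - h + (w.sum : L)) * virVertex h ht w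

/-- The basis word `L_{-l₁} ⋯ L_{-lₛ}` with `l₁ ≥ ⋯ ≥ lₛ` labelled by a partition. -/
def partitionWord {n : ℕ} (Y : n.Partition) : List ℕ :=
  Y.parts.sort (· ≥ ·)

/-- The Gram matrix of the Verma module of central charge `c` and dimension `ht` at level `n`. -/
def gramMatrix (c ht : L) (n : ℕ) : Matrix n.Partition n.Partition L :=
  Matrix.of fun Y Y' =>
    matrixElement c ht (partitionWord Y) (Finsupp.single (partitionWord Y') 1)

/-- The `n`-th coefficient `F_n(h, ht, c)` of the conformal block with four equal external
dimensions `h` and intermediate dimension `ht`. -/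
def blockCoeff (h ht c : L) (n : ℕ) : L :=
  ∑ Y : n.Partition, ∑ Y' : n.Partition,
    virVertex h ht (partitionWord Y) * (gramMatrix c ht n)⁻¹ Y Y' * virVertex h ht (partitionWord Y')

/-- The conformal block `F(h, ht, c | z) = 1 + F_1 z + F_2 z² + ⋯`. -/
def virBlock (h ht c : L) : L⟦X⟧ :=
  PowerSeries.mk (blockCoeff h ht c)

/-- The logarithmic conformal block `f = log F = ∑ g_n zⁿ`. -/
def logBlock [Algebra ℚ L] (h ht c : L) : L⟦X⟧ :=
  PowerSeries.logOf (virBlock h ht c)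

end Block

/-! ### Large-`c` expansion

Puiseux series near `c = ∞` are elements of the field of Hahn series in `1 / c` with rational
exponents. -/

section LargeC

variable {K : Type*} [Field K]

/-- The monomial `x c^a`. -/
def cMonomial (x : K) (a : ℚ) : HahnSeries ℚ K :=
  HahnSeries.single (-a) x

variable [CharZero K]

/-- The `α`-heavy logarithmic block: `h = δ c^α`, `ht = δt c^α`. -/
def heavyLogBlock (δ δt : K) (α : ℚ) : (HahnSeries ℚ K)⟦X⟧ :=
  logBlock (cMonomial δ α) (cMonomial δt α) (cMonomial 1 1)

/-- The coefficient `f_a^{(α)}(δ, δt | z)` of `c^a` in the large-`c` expansion of the `α`-heavy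
logarithmic block, up to `O(z⁶)`. -/
def puiseuxCoeff (δ δt : K) (α a : ℚ) : K[X] :=
  PowerSeries.trunc 6
    (PowerSeries.mk fun n => (PowerSeries.coeff n (heavyLogBlock δ δt α)).coeff (-a))

/-- The principal part of the `α`-heavy logarithmic block up to `O(z⁶)`: the coefficients of the
non-negative powers of `c`, as a function of the exponent. -/
def prinPart (δ δt : K) (α : ℚ) : ℚ → K[X] :=
  fun a => if 0 ≤ a then puiseuxCoeff δ δt α a else 0

end LargeC

/-- The exceptional points `M / (M + 1)` and `(N + 1) / N` with `M, N ≥ 1`. -/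
def IsExceptionalExponent (α : ℚ) : Prop :=
  (∃ M : ℕ, 1 ≤ M ∧ α = (M : ℚ) / (M + 1)) ∨ (∃ N : ℕ, 1 ≤ N ∧ α = ((N : ℚ) + 1) / N)

/-- Regular points: the positive rationals other than `1` that are not exceptional. -/
def IsRegularExponent (α : ℚ) : Prop :=
  0 < α ∧ α ≠ 1 ∧ ¬ IsExceptionalExponent α

end

/-! Write `t = δt c^α`. The logarithm of the block exponentiates at large `c`: each coefficient of
`log F` up to `z^5` is `t` times a rational function of `κ = h / t = δ / δt`, of the ratio `u` of
the smaller of `c`, `t` to the larger, and of `v = 1 / t`. This function is regular at `u = v = 0`,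
because the denominators are Kac factors whose leading coefficients there are nonzero. In powers of
`c`, `u` has degree `-θ` with `θ = |1 - α|`, and `v` has degree `-α`.

Since `t` has degree `α`, the principal part only sees the function up to order `α` in `1 / c`. To
this order `v` enters at most linearly and not together with `u`, so the function is `f(u) + b v`,
where `f` and `b` do not depend on `α` on either side of `1`. Hence the non-negative powers are
`c^(α - iθ)` with universal coefficients `p i`, and `c^0` with a universal coefficient `q` coming
from `t v = 1`. At a regular point no exponent `α - iθ` vanishes and the constant term is `q`. At an
exceptional point exactly one vanishes and the constant term is `p i + q`. Thus `p i` is the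
difference of the exceptional and the regular constant terms, and counting the positive exponents `α
- iθ` gives both formulas.

Exponentiation is checked on explicit polynomials: the Gram matrices up to level five are computed,
their linear systems solved, and the logarithm taken (`coeff_two_logBlock_mul`,
`coeff_four_logBlock_mul`). Invertibility comes from a valuation argument
(`AddValuation.det_ne_zero_of_dominant_diagonal`), the truncated expansion from the calculus of
`FirstOrder`, and its uniformity in `α` from `exists_firstOrder_logBlock`. -/

noncomputable section

/-! ### Recursive evaluation of matrix elements. -/

section Gram

variable {L : Type*} [Field L]

/-- The matrix element `⟨ht| L_{kᵣ} ⋯ L_{k₁} L_{-l₁} ⋯ L_{-lₛ} |ht⟩` of two words. -/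
def wordPairing (c ht : L) (ks w : List ℕ) : L :=
  matrixElement c ht ks (Finsupp.single w 1)

/-- The value of a linear functional, given on words, at `L_n L_{-l₁} ⋯ L_{-lₛ} |ht⟩`. -/
def raiseEval (c ht : L) (f : List ℕ → L) (w : List ℕ) (n : ℕ) : L :=
  Finsupp.linearCombination L f (virAct c ht w n)

theorem matrixElement_eq (c ht : L) (ks : List ℕ) (v : List ℕ →₀ L) :
    matrixElement c ht ks v = Finsupp.linearCombination L (wordPairing c ht ks) v := by
  induction ks generalizing v with
  | nil =>
    simp only [matrixElement, Finsupp.linearCombination_apply, wordPairing, Finsupp.single_apply,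
      smul_eq_mul, mul_ite, mul_one, mul_zero]
    rw [Finsupp.sum_ite_eq' v [] (fun _ b => b)]
    simp +contextual
  | cons k ks ih =>
    simp only [matrixElement]
    rw [ih, Finsupp.linearCombination_linearCombination]
    congr 2
    funext w
    rw [wordPairing, matrixElement, Finsupp.linearCombination_single, one_smul, ih]

theorem wordPairing_nil (c ht : L) : wordPairing c ht [] [] = 1 := by
  simp [wordPairing, matrixElement]

theorem wordPairing_cons (c ht : L) (k : ℕ) (ks w : List ℕ) :
    wordPairing c ht (k :: ks) w = raiseEval c ht (wordPairing c ht ks) w k := by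
  rw [raiseEval, ← matrixElement_eq, wordPairing, matrixElement, Finsupp.linearCombination_single,
    one_smul]

theorem raiseEval_nil_succ (c ht : L) (f : List ℕ → L) (n : ℕ) :
    raiseEval c ht f [] (n + 1) = 0 := by
  have h1 : ¬ ((n : ℤ) + 1 < 0) := by lia
  have h2 : ¬ ((n : ℤ) + 1 = 0) := by lia
  simp [raiseEval, virAct, h1, h2]

theorem raiseEval_zero (c ht : L) (f : List ℕ → L) (w : List ℕ) (hw : ∀ l ∈ w, 0 < l) :
    raiseEval c ht f w 0 = (ht + (w.sum : L)) * f w := by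
  induction w generalizing f with
  | nil => simp [raiseEval, virAct]
  | cons l w ih =>
    have hl : (0 : ℤ) - l < 0 := by have := hw l (by simp); lia
    have hl' : (0 : ℤ) ≠ l := by lia
    have h1 : virAct c ht w ((0 : ℤ) - l) = Finsupp.single (l :: w) 1 := by
      have : ((0 : ℤ) - l).natAbs = l := by lia
      cases w <;> simp only [virAct, hl, if_true, this]
    have := ih (fun w => f (l :: w)) (fun m hm => hw m (by simp [hm]))
    simp only [raiseEval, Nat.cast_zero] at this ⊢
    rw [virAct, if_neg (lt_irrefl _), if_neg hl', add_zero, map_add, map_smul, h1,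
      Finsupp.linearCombination_single, Finsupp.linearCombination_mapDomain, Function.comp_def, this]
    simp
    ring

/-- Together with `raiseEval_nil_succ` and `raiseEval_zero` this gives rewriting rules that reduce
every Gram entry to a polynomial. In the branch `n < l` the operator `L_{n-l}` is a lowering one and
simply becomes a new first letter. -/
theorem raiseEval_cons (c ht : L) (f : List ℕ → L) (l : ℕ) (w : List ℕ) (n : ℕ) :
    raiseEval c ht f (l :: w) n =
      raiseEval c ht (fun w => f (l :: w)) w n
        + ((n : L) + (l : L)) * (if n < l then f ((l - n) :: w) else raiseEval c ht f w (n - l))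
        + (if n = l then c / 12 * ((n : L) ^ 3 - (n : L)) * f w else 0) := by
  have h0 : ¬ ((n : ℤ) < 0) := by lia
  simp only [raiseEval]
  rw [virAct, if_neg h0, map_add, map_add, map_smul, Finsupp.linearCombination_mapDomain,
    Function.comp_def]
  congr 2
  · simp only [smul_eq_mul, Int.cast_natCast]
    congr 1
    split_ifs with h
    · have h1 : (n : ℤ) - l < 0 := by lia
      have h2 : ((n : ℤ) - l).natAbs = l - n := by lia
      cases w <;> simp [virAct, h1, h2]
    · rw [Nat.cast_sub (by lia)]
  · by_cases h : n = l
    · rw [if_pos h, if_pos (by exact_mod_cast h), Finsupp.linearCombination_single]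
      simp
    · simp [h]

end Gram

/-! ### From partitions to explicit lists of words. -/

section Enumeration

variable {L : Type*} [Field L]

/-- A complete list of the partitions of `n`, as non-increasing words of positive integers. -/
structure IsPartitionEnum (n : ℕ) {m : ℕ} (words : Fin m → List ℕ) : Prop where
  injective : Function.Injective words
  pairwise : ∀ i, (words i).Pairwise (· ≥ ·)
  pos : ∀ i, ∀ l ∈ words i, 0 < l
  sum_eq : ∀ i, (words i).sum = n
  complete : ∀ w : List ℕ, w.Pairwise (· ≥ ·) → (∀ l ∈ w, 0 < l) → w.sum = n → ∃ i, words i = w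

theorem IsPartitionEnum.exists_equiv {n m : ℕ} {words : Fin m → List ℕ}
    (hw : IsPartitionEnum n words) :
    ∃ e : Fin m ≃ n.Partition, ∀ i, partitionWord (e i) = words i := by
  let p : Fin m → n.Partition := fun i =>
    ⟨(words i : Multiset ℕ), fun {l} hl => hw.pos i l (by simpa using hl), by simp [hw.sum_eq i]⟩
  have hp : ∀ i, partitionWord (p i) = words i := fun i => by
    simp only [partitionWord, p, Multiset.coe_sort]
    exact List.mergeSort_eq_self _ (by simpa using hw.pairwise i)
  refine ⟨Equiv.ofBijective p ⟨fun i j hij => hw.injective ?_, fun Y => ?_⟩, hp⟩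
  · rw [← hp i, ← hp j, hij]
  · obtain ⟨i, hi⟩ := hw.complete (partitionWord Y) (Multiset.pairwise_sort _ _)
      (fun l hl => Y.parts_pos (by simpa [partitionWord] using hl))
      (by rw [partitionWord, ← Multiset.sum_coe, Multiset.sort_eq, Y.parts_sum])
    refine ⟨i, Nat.Partition.ext ?_⟩
    change (words i : Multiset ℕ) = _
    rw [hi, partitionWord, Multiset.sort_eq]

/-- The Gram matrix of a family of words. -/
def wordGram (c ht : L) {m : ℕ} (words : Fin m → List ℕ) : Matrix (Fin m) (Fin m) L :=
  Matrix.of fun i j => wordPairing c ht (words i) (words j)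

theorem IsPartitionEnum.det_gramMatrix {n m : ℕ} {words : Fin m → List ℕ}
    (hw : IsPartitionEnum n words) (c ht : L) :
    (gramMatrix c ht n).det = (wordGram c ht words).det := by
  obtain ⟨e, he⟩ := hw.exists_equiv
  rw [← Matrix.det_submatrix_equiv_self e]
  congr 1
  ext i j
  simp [gramMatrix, wordGram, wordPairing, he]

/-- For an invertible Gram matrix `G` the vector `G⁻¹ γ` is the only solution of `G x = γ`, so
exhibiting a solution suffices and no inverse has to be computed. -/
theorem IsPartitionEnum.blockCoeff_eq {n m : ℕ} {words : Fin m → List ℕ}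
    (hw : IsPartitionEnum n words) (h c ht : L) (hdet : (wordGram c ht words).det ≠ 0)
    (x : Fin m → L)
    (hx : (wordGram c ht words).mulVec x = fun i => virVertex h ht (words i)) :
    blockCoeff h ht c n = ∑ i, virVertex h ht (words i) * x i := by
  obtain ⟨e, he⟩ := hw.exists_equiv
  have hG : (gramMatrix c ht n).submatrix e e = wordGram c ht words := by
    ext i j
    simp [gramMatrix, wordGram, wordPairing, he]
  have hinv : (gramMatrix c ht n)⁻¹.submatrix e e = (wordGram c ht words)⁻¹ := by
    rw [← hG, Matrix.inv_submatrix_equiv]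
  have hx' : (wordGram c ht words)⁻¹.mulVec (fun i => virVertex h ht (words i)) = x := by
    rw [← hx, Matrix.mulVec_mulVec, Matrix.nonsing_inv_mul _ (isUnit_iff_ne_zero.mpr hdet),
      Matrix.one_mulVec]
  rw [blockCoeff, ← e.sum_comp]
  refine Finset.sum_congr rfl fun i _ => ?_
  rw [← e.sum_comp, ← hx', Matrix.mulVec, dotProduct, Finset.mul_sum]
  refine Finset.sum_congr rfl fun j _ => ?_
  rw [he, he, ← hinv, Matrix.submatrix_apply]
  ring

end Enumeration

/-! ### Partitions and Gram matrices at levels 0 to 5. -/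

section Levels

/-- The partitions of `0`. -/
def words0 : Fin 1 → List ℕ :=
  ![[]]

theorem isPartitionEnum_words0 : IsPartitionEnum 0 words0 where
  injective := by decide
  pairwise := by decide
  pos := by decide
  sum_eq := by decide
  complete := by
    rintro w h1 h2 h3
    -- Six or more positive letters have sum at least 6, so the same split by length serves all
    -- levels up to five.
    rcases w with _ | ⟨a, _ | ⟨b, _ | ⟨c, _ | ⟨d, _ | ⟨e, _ | ⟨f, w⟩⟩⟩⟩⟩⟩ <;>
      simp [words0] at h1 h2 h3 ⊢ <;> lia

/-- The partitions of `1`. -/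
def words1 : Fin 1 → List ℕ :=
  ![[1]]

theorem isPartitionEnum_words1 : IsPartitionEnum 1 words1 where
  injective := by decide
  pairwise := by decide
  pos := by decide
  sum_eq := by decide
  complete := by
    rintro w h1 h2 h3
    rcases w with _ | ⟨a, _ | ⟨b, _ | ⟨c, _ | ⟨d, _ | ⟨e, _ | ⟨f, w⟩⟩⟩⟩⟩⟩ <;>
      simp [words1] at h1 h2 h3 ⊢ <;> lia

/-- The partitions of `2`. -/
def words2 : Fin 2 → List ℕ :=
  ![[2], [1, 1]]

theorem isPartitionEnum_words2 : IsPartitionEnum 2 words2 where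
  injective := by decide
  pairwise := by decide
  pos := by decide
  sum_eq := by decide
  complete := by
    rintro w h1 h2 h3
    rcases w with _ | ⟨a, _ | ⟨b, _ | ⟨c, _ | ⟨d, _ | ⟨e, _ | ⟨f, w⟩⟩⟩⟩⟩⟩ <;>
      simp [words2, Fin.exists_fin_succ] at h1 h2 h3 ⊢ <;> lia

/-- The partitions of `3`. -/
def words3 : Fin 3 → List ℕ :=
  ![[3], [2, 1], [1, 1, 1]]

theorem isPartitionEnum_words3 : IsPartitionEnum 3 words3 where
  injective := by decide
  pairwise := by decide
  pos := by decide
  sum_eq := by decide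
  complete := by
    rintro w h1 h2 h3
    rcases w with _ | ⟨a, _ | ⟨b, _ | ⟨c, _ | ⟨d, _ | ⟨e, _ | ⟨f, w⟩⟩⟩⟩⟩⟩ <;>
      simp [words3, Fin.exists_fin_succ] at h1 h2 h3 ⊢ <;> lia

/-- The partitions of `4`. -/
def words4 : Fin 5 → List ℕ :=
  ![[4], [3, 1], [2, 2], [2, 1, 1], [1, 1, 1, 1]]

theorem isPartitionEnum_words4 : IsPartitionEnum 4 words4 where
  injective := by decide
  pairwise := by decide
  pos := by decide
  sum_eq := by decide
  complete := by
    rintro w h1 h2 h3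
    rcases w with _ | ⟨a, _ | ⟨b, _ | ⟨c, _ | ⟨d, _ | ⟨e, _ | ⟨f, w⟩⟩⟩⟩⟩⟩ <;>
      simp [words4, Fin.exists_fin_succ] at h1 h2 h3 ⊢ <;> lia

/-- The partitions of `5`. -/
def words5 : Fin 7 → List ℕ :=
  ![[5], [4, 1], [3, 2], [3, 1, 1], [2, 2, 1], [2, 1, 1, 1], [1, 1, 1, 1, 1]]

theorem isPartitionEnum_words5 : IsPartitionEnum 5 words5 where
  injective := by decide
  pairwise := by decide
  pos := by decide
  sum_eq := by decide
  complete := by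
    rintro w h1 h2 h3
    rcases w with _ | ⟨a, _ | ⟨b, _ | ⟨c, _ | ⟨d, _ | ⟨e, _ | ⟨f, w⟩⟩⟩⟩⟩⟩ <;>
      simp [words5, Fin.exists_fin_succ] at h1 h2 h3 ⊢ <;> lia

variable {L : Type*} [Field L]

theorem wordGram_words0 (c t : L) : wordGram c t words0 =
    !![1] := by
  ext i j
  fin_cases i; fin_cases j
  simp [wordGram, words0, wordPairing_nil]

variable [CharZero L]

theorem wordGram_words1 (c t : L) : wordGram c t words1 =
    !![2*t] := by
  ext i j
  fin_cases i; fin_cases j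
  norm_num [wordGram, words1, wordPairing_cons, wordPairing_nil, raiseEval_nil_succ, raiseEval_cons,
    raiseEval_zero]

theorem wordGram_words2 (c t : L) : wordGram c t words2 =
    !![1/2*c + 4*t, 6*t;
     6*t, 8*t^2 + 4*t] := by
  ext i j
  fin_cases i <;> fin_cases j <;>
    simp [wordGram, words2, wordPairing_cons, wordPairing_nil, raiseEval_nil_succ, raiseEval_cons,
      raiseEval_zero] <;> ring

theorem wordGram_words3 (c t : L) : wordGram c t words3 =
    !![2*c + 6*t, 10*t, 24*t;
     10*t, c*t + 8*t^2 + 8*t, 36*t^2 + 12*t;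
     24*t, 36*t^2 + 12*t, 48*t^3 + 72*t^2 + 24*t] := by
  ext i j
  fin_cases i <;> fin_cases j <;>
    simp [wordGram, words3, wordPairing_cons, wordPairing_nil, raiseEval_nil_succ, raiseEval_cons,
      raiseEval_zero] <;> ring

set_option maxHeartbeats 4000000 in
theorem wordGram_words4 (c t : L) : wordGram c t words4 =
    !![5*c + 8*t, 14*t, 3*c + 24*t, 36*t, 120*t;
     14*t, 4*c*t + 12*t^2 + 12*t, 30*t, 40*t^2 + 20*t, 192*t^2 + 48*t;
     3*c + 24*t, 30*t, 1/2*c^2 + 8*c*t + 4*c + 32*t^2 + 32*t, 6*c*t + 48*t^2 + 48*t,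
       216*t^2 + 144*t;
     36*t, 40*t^2 + 20*t, 6*c*t + 48*t^2 + 48*t, 4*c*t^2 + 2*c*t + 32*t^3 + 116*t^2 + 32*t,
       288*t^3 + 336*t^2 + 96*t;
     120*t, 192*t^2 + 48*t, 216*t^2 + 144*t, 288*t^3 + 336*t^2 + 96*t,
       384*t^4 + 1152*t^3 + 1056*t^2 + 288*t] := by
  ext i j
  fin_cases i <;> fin_cases j <;>
    simp [wordGram, words4, wordPairing_cons, wordPairing_nil, raiseEval_nil_succ, raiseEval_cons,
      raiseEval_zero] <;> ring

set_option maxHeartbeats 4000000 in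
theorem wordGram_words5 (c t : L) : wordGram c t words5 =
    !![10*c + 10*t, 18*t, 4*c + 32*t, 48*t, 70*t, 168*t, 720*t;
     18*t, 10*c*t + 16*t^2 + 16*t, 42*t, 56*t^2 + 28*t, 6*c*t + 48*t^2 + 48*t, 216*t^2 + 72*t,
       1200*t^2 + 240*t;
     4*c + 32*t, 42*t, c^2 + 11*c*t + 6*c + 24*t^2 + 48*t, 12*c*t + 36*t^2 + 72*t,
       10*c*t + 80*t^2 + 90*t, 12*c*t + 276*t^2 + 180*t, 1440*t^2 + 720*t;
     48*t, 56*t^2 + 28*t, 12*c*t + 36*t^2 + 72*t, 16*c*t^2 + 8*c*t + 48*t^3 + 120*t^2 + 48*t,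
       240*t^2 + 60*t, 240*t^3 + 504*t^2 + 120*t, 1920*t^3 + 1920*t^2 + 480*t;
     70*t, 6*c*t + 48*t^2 + 48*t, 10*c*t + 80*t^2 + 90*t, 240*t^2 + 60*t,
       c^2*t + 16*c*t^2 + 24*c*t + 64*t^3 + 192*t^2 + 128*t,
       36*c*t^2 + 12*c*t + 288*t^3 + 672*t^2 + 192*t, 2160*t^3 + 2880*t^2 + 720*t;
     168*t, 216*t^2 + 72*t, 12*c*t + 276*t^2 + 180*t, 240*t^3 + 504*t^2 + 120*t,
       36*c*t^2 + 12*c*t + 288*t^3 + 672*t^2 + 192*t,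
       24*c*t^3 + 36*c*t^2 + 12*c*t + 192*t^4 + 1512*t^3 + 1392*t^2 + 360*t,
       2880*t^4 + 7200*t^3 + 5760*t^2 + 1440*t;
     720*t, 1200*t^2 + 240*t, 1440*t^2 + 720*t, 1920*t^3 + 1920*t^2 + 480*t,
       2160*t^3 + 2880*t^2 + 720*t, 2880*t^4 + 7200*t^3 + 5760*t^2 + 1440*t,
       3840*t^5 + 19200*t^4 + 33600*t^3 + 24000*t^2 + 5760*t] := by
  ext i j
  fin_cases i <;> fin_cases j <;>
    simp [wordGram, words5, wordPairing_cons, wordPairing_nil, raiseEval_nil_succ, raiseEval_cons,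
      raiseEval_zero] <;> ring

end Levels

/-! ### Block coefficients from the linear systems. -/

section Solutions

variable {L : Type*} [Field L]

theorem IsPartitionEnum.exists_solution {n m : ℕ} {words : Fin m → List ℕ}
    (hw : IsPartitionEnum n words) (h c ht : L) (hdet : (wordGram c ht words).det ≠ 0) :
    ∃ x : Fin m → L, (wordGram c ht words).mulVec x = (fun i => virVertex h ht (words i)) ∧
      blockCoeff h ht c n = ∑ i, virVertex h ht (words i) * x i := by
  have hx : (wordGram c ht words).mulVec
      ((wordGram c ht words)⁻¹.mulVec (fun i => virVertex h ht (words i))) =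
        fun i => virVertex h ht (words i) := by
    rw [Matrix.mulVec_mulVec, Matrix.mul_nonsing_inv _ (isUnit_iff_ne_zero.mpr hdet),
      Matrix.one_mulVec]
  exact ⟨_, hx, hw.blockCoeff_eq h c ht hdet _ hx⟩

theorem blockCoeff_zero (h t c : L) : blockCoeff h t c 0 = 1 := by
  rw [isPartitionEnum_words0.blockCoeff_eq h c t (by rw [wordGram_words0]; simp) ![1]]
  · simp [words0, virVertex]
  · rw [wordGram_words0]
    ext i
    fin_cases i
    simp [words0, virVertex]

variable [CharZero L]

theorem blockCoeff_one (h t c : L) (ht : t ≠ 0) : blockCoeff h t c 1 = t / 2 := by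
  rw [isPartitionEnum_words1.blockCoeff_eq h c t (by rw [wordGram_words1]; simpa using ht) ![1 / 2]]
  · simp [words1, virVertex]
    ring
  · rw [wordGram_words1]
    ext i
    fin_cases i
    simp [words1, virVertex]

/-- The Kac factor of level two that does not vanish at `t = 0`. -/
def kac2 (t c : L) : L := 2*c*t + c + 16*t^2 - 10*t

/-- The product of the Kac factors of level four that do not occur at lower levels. -/
def kac4 (t c : L) : L := (c + 8*t - 1) * (20*c*t + 30*c + 32*t^2 - 164*t + 132)

/-- The level-two determinant is `2 * t * kac2 t c`; the factor `t` cancels in the solution, which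
leaves `kac2` as the only denominator. -/
theorem blockCoeff_two (h t c : L) (hdet : (wordGram c t words2).det ≠ 0) (h2 : kac2 t c ≠ 0) :
    blockCoeff h t c 2 * kac2 t c =
    1/4*c*t^3 + 1/2*c*t^2 + 1/4*c*t + 2*t^4 + 2*t^3 + 2*t^2*h - 2*t^2 + 4*t*h^2 - 2*t*h + 2*h^2 := by
  rw [isPartitionEnum_words2.blockCoeff_eq h c t hdet
    ![(t^2 + 4*t*h - t + 2*h) / kac2 t c,
      (1/4*c*t + 1/4*c + 2*t^2 - t - 3*h) / kac2 t c]]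
  · simp [words2, virVertex]
    field_simp
    ring
  · rw [wordGram_words2]
    ext i
    fin_cases i <;> simp [words2, virVertex, Matrix.mulVec, dotProduct] <;>
      field_simp <;> rw [kac2] <;> ring

/-- Equal external dimensions give the symmetry `F(z) = (1 - z)^(-t) F(z / (z - 1))`, which
determines odd levels from even ones. For the states it says that the odd part is `tanh(L_{-1} / 2)`
applied to the even part. With `tanh(y / 2) = y/2 - y³/24 + y⁵/240 - ⋯`, the level-three solution is
`L_{-1} x / 2 - L_{-1}³ / 24`, where `x` solves level two. The symmetry only suggests the witness,
which is then verified row by row. -/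
theorem blockCoeff_three (h t c : L) (hdet2 : (wordGram c t words2).det ≠ 0)
    (hdet3 : (wordGram c t words3).det ≠ 0) :
    blockCoeff h t c 3 = (t + 2) / 2 * blockCoeff h t c 2 - t * (t + 1) * (t + 2) / 24 := by
  obtain ⟨x, hx, hF⟩ := isPartitionEnum_words2.exists_solution h c t hdet2
  rw [wordGram_words2] at hx
  have e0 := congrFun hx 0
  have e1 := congrFun hx 1
  simp [words2, virVertex, Matrix.mulVec, dotProduct, Fin.sum_univ_succ] at e0 e1
  rw [isPartitionEnum_words3.blockCoeff_eq h c t hdet3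
    ![x 0 / 2, x 0 / 2, x 1 / 2 - 1 / 24], hF]
  · simp [words2, words3, virVertex, Fin.sum_univ_succ]
    ring
  · rw [wordGram_words3]
    ext i
    fin_cases i <;>
      simp [words3, virVertex, Matrix.mulVec, dotProduct, Fin.sum_univ_succ]
    · linear_combination ((4) / 2) * e0
    · linear_combination ((2*t) / 2) * e0 + ((3) / 2) * e1
    · linear_combination ((6*t + 6) / 2) * e1

theorem blockCoeff_five (h t c : L) (hdet2 : (wordGram c t words2).det ≠ 0)
    (hdet4 : (wordGram c t words4).det ≠ 0) (hdet5 : (wordGram c t words5).det ≠ 0) :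
    blockCoeff h t c 5 = (t + 4) / 2 * blockCoeff h t c 4
      - (t + 2) * (t + 3) * (t + 4) / 24 * blockCoeff h t c 2
      + t * (t + 1) * (t + 2) * (t + 3) * (t + 4) / 240 := by
  obtain ⟨x, hx, hF2⟩ := isPartitionEnum_words2.exists_solution h c t hdet2
  obtain ⟨y, hy, hF4⟩ := isPartitionEnum_words4.exists_solution h c t hdet4
  rw [wordGram_words2] at hx
  have e0 := congrFun hx 0
  have e1 := congrFun hx 1
  rw [wordGram_words4] at hy
  have f0 := congrFun hy 0
  have f1 := congrFun hy 1
  have f2 := congrFun hy 2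
  have f3 := congrFun hy 3
  have f4 := congrFun hy 4
  simp [words2, virVertex, Matrix.mulVec, dotProduct, Fin.sum_univ_succ] at e0 e1
  simp [words4, virVertex, Matrix.mulVec, dotProduct, Fin.sum_univ_succ]
    at f0 f1 f2 f3 f4
  -- The witness is `L_{-1} y / 2 - L_{-1}³ x / 24 + L_{-1}⁵ / 240`, rewritten in non-increasing
  -- words by moving every `L_{-1}` to the right.
  rw [isPartitionEnum_words5.blockCoeff_eq h c t hdet5
    ![(3 * y 0 + 1 * y 2) / 2 - 6 * x 0 / 24,
      (1 * y 0 + 2 * y 1) / 2 - 6 * x 0 / 24,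
      (2 * y 2) / 2,
      (1 * y 1 + 1 * y 3) / 2 - 3 * x 0 / 24,
      (1 * y 2) / 2,
      (1 * y 3) / 2 - 1 * x 0 / 24,
      (1 * y 4) / 2 - 1 * x 1 / 24 + 1 / 240], hF2, hF4]
  · simp [words2, words4, words5, virVertex, Fin.sum_univ_succ]
    ring
  · rw [wordGram_words5]
    ext i
    fin_cases i <;>
      simp [words5, virVertex, Matrix.mulVec, dotProduct, Fin.sum_univ_succ]
    · linear_combination ((6) / 2) * f0 - ((120) / 24) * e0
    · linear_combination ((2*t) / 2) * f0 + ((5) / 2) * f1 - ((120*t) / 24) * e0 - ((60) / 24) *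
      e1
    · linear_combination ((3) / 2) * f1 + ((4) / 2) * f2 - ((96*t + 48) / 24) * e0 - ((108) /
      24) * e1
    · linear_combination ((4*t + 2) / 2) * f1 + ((4) / 2) * f3 - ((96*t^2 + 48*t) / 24) * e0 -
      ((168*t + 120) / 24) * e1
    · linear_combination ((3) / 2) * f1 + ((2*t) / 2) * f2 + ((6) / 2) * f3 - ((72*t^2 + 96*t) /
      24) * e0 - ((216*t + 180) / 24) * e1
    · linear_combination ((6*t + 6) / 2) * f3 + ((3) / 2) * f4 - ((48*t^3 + 72*t^2 + 24*t) / 24)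
      * e0 - ((324*t^2 + 684*t + 360) / 24) * e1
    · linear_combination ((10*t + 20) / 2) * f4 - ((480*t^3 + 2160*t^2 + 3120*t + 1440) / 24) *
      e1

/-- Numerators of the solution of the linear system of level four. -/
def num4 (h t c : L) : Fin 5 → L :=
  ![11/2*c^2*t^3 + 24*c^2*t^2*h + 7/2*c^2*t^2 + 48*c^2*t*h - 9*c^2*t + 18*c^2*h + 53*c*t^4 +
    232*c*t^3*h - 42*c*t^3 - 48*c*t^2*h^2 + 140*c*t^2*h + 16*c*t^2 - 96*c*t*h^2 + 174*c*t*h -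
    27*c*t - 36*c*h^2 + 54*c*h + 72*t^5 + 320*t^4*h - 453*t^4 - 384*t^3*h^2 - 1224*t^3*h + 720*t^3 +
    432*t^2*h^2 + 520*t^2*h - 375*t^2 - 264*t*h^2 + 516*t*h + 36*t + 36*h^2 - 72*h,
    5*c^2*t^3 + 20*c^2*t^2*h + 15/4*c^2*t^2 + 40*c^2*t*h - 35/4*c^2*t + 15*c^2*h + 48*c*t^4 +
    192*c*t^3*h - 30*c*t^3 + 88*c*t^2*h + 23/2*c*t^2 + 182*c*t*h - 59/2*c*t + 48*c*h + 64*t^5 +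
    256*t^4*h - 400*t^4 - 1344*t^3*h + 650*t^3 + 768*t^2*h^2 + 524*t^2*h - 350*t^2 - 624*t*h^2 +
    576*t*h + 36*t + 36*h^2 - 72*h,
    5*c*t^4 + 40*c*t^3*h + 2*c*t^3 + 80*c*t^2*h^2 + 36*c*t^2*h - c*t^2 + 160*c*t*h^2 - 28*c*t*h -
    6*c*t + 60*c*h^2 + 12*c*h + 8*t^5 + 64*t^4*h - 51*t^4 + 128*t^3*h^2 - 376*t^3*h + 90*t^3 -
    304*t^2*h^2 + 164*t^2*h - 53*t^2 + 416*t*h^2 + 100*t*h + 6*t - 60*h^2 - 12*h,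
    5/2*c^2*t^3 + 10*c^2*t^2*h + 5/2*c^2*t^2 + 25*c^2*t*h - 5*c^2*t + 15*c^2*h + 24*c*t^4 +
    96*c*t^3*h - 25/2*c*t^3 + 64*c*t^2*h - 12*c*t^2 - 120*c*t*h^2 + 119*c*t*h + 1/2*c*t -
    180*c*h^2 + 21*c*h + 32*t^5 + 128*t^4*h - 196*t^4 - 640*t^3*h + 295*t^3 - 192*t^2*h^2 +
    678*t^2*h - 140*t^2 - 216*t*h^2 - 48*t*h + 9*t + 108*h^2 - 18*h,
    5/48*c^3*t^2 + 25/48*c^3*t + 5/8*c^3 + 11/6*c^2*t^3 + 247/48*c^2*t^2 - 15/2*c^2*t*h +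
    103/48*c^2*t - 15*c^2*h + 17/8*c^2 + 28/3*c*t^4 + c*t^3 - 72*c*t^2*h - 307/24*c*t^2 -
    69/2*c*t*h + 545/24*c*t + 45*c*h^2 - 87/2*c*h - 11/4*c + 32/3*t^5 - 164/3*t^4 - 96*t^3*h +
    133/3*t^3 + 492*t^2*h - 5/6*t^2 + 72*t*h^2 - 465*t*h + 1/2*t - 27*h^2 + 54*h]

set_option maxHeartbeats 4000000 in
theorem blockCoeff_four (h t c : L) (hdet : (wordGram c t words4).det ≠ 0) (h2 : kac2 t c ≠ 0)
    (h4 : kac4 t c ≠ 0) :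
    blockCoeff h t c 4 * (kac2 t c * kac4 t c) =
    5/48*c^3*t^6 + 55/48*c^3*t^5 + 235/48*c^3*t^4 + 485/48*c^3*t^3 + 10*c^3*t^2 + 15/4*c^3*t +
    11/6*c^2*t^7 + 895/48*c^2*t^6 + 5*c^2*t^5*h + 1091/16*c^2*t^5 + 10*c^2*t^4*h^2 + 30*c^2*t^4*h +
    5009/48*c^2*t^4 + 75*c^2*t^3*h^2 + 43*c^2*t^3*h + 2675/48*c^2*t^3 + 192*c^2*t^2*h^2 -
    24*c^2*t^2*h + 17/2*c^2*t^2 + 189*c^2*t*h^2 - 54*c^2*t*h + 51/4*c^2*t + 54*c^2*h^2 +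
    28/3*c*t^8 + 81*c*t^7 + 48*c*t^6*h + 1667/8*c*t^6 + 96*c*t^5*h^2 + 235*c*t^5*h + 2267/24*c*t^5 +
    634*c*t^4*h^2 + 177*c*t^4*h - 2861/24*c*t^4 + 80*c*t^3*h^3 + 1211*c*t^3*h^2 - 225*c*t^3*h +
    2977/24*c*t^3 + 80*c*t^2*h^4 + 72*c*t^2*h^3 + 938*c*t^2*h^2 - 49*c*t^2*h + 77/2*c*t^2 +
    160*c*t*h^4 - 56*c*t*h^3 + 595*c*t*h^2 - 186*c*t*h - 33/2*c*t + 60*c*h^4 + 24*c*h^3 +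
    186*c*h^2 + 32/3*t^9 + 124/3*t^8 + 64*t^7*h - 583/3*t^7 + 128*t^6*h^2 - 40*t^6*h - 4801/6*t^6 +
    144*t^5*h^2 - 1142*t^5*h + 1759/6*t^5 + 128*t^4*h^3 - 2416*t^4*h^2 + 348*t^4*h + 9515/6*t^4 +
    128*t^3*h^4 - 752*t^3*h^3 - 2238*t^3*h^2 + 2806*t^3*h - 2083/2*t^3 - 304*t^2*h^4 + 328*t^2*h^3 +
    3068*t^2*h^2 - 2276*t^2*h + 105*t^2 + 416*t*h^4 + 200*t*h^3 + 1574*t*h^2 + 240*t*h - 60*h^4 -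
    24*h^3 - 240*h^2 := by
  rw [isPartitionEnum_words4.blockCoeff_eq h c t hdet
    fun i => num4 h t c i / (kac2 t c * kac4 t c)]
  · simp_rw [← mul_div_assoc]
    rw [← Finset.sum_div, div_mul_cancel₀ _ (mul_ne_zero h2 h4)]
    simp [words4, virVertex, Fin.sum_univ_succ, num4]
    ring
  · rw [wordGram_words4]
    ext i
    simp_rw [Matrix.mulVec, dotProduct, ← mul_div_assoc]
    rw [← Finset.sum_div, div_eq_iff (mul_ne_zero h2 h4)]
    fin_cases i <;>
      simp [words4, virVertex, Fin.sum_univ_succ, num4, kac2, kac4] <;> ring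

end Solutions

/-! ### Invertibility from valuations. -/

section Valuation

variable {F : Type*} [Field F] (v : AddValuation F (WithTop ℚ))

/-- Rescaling rows and columns by half the diagonal orders would make the matrix a unit diagonal
plus a small perturbation. To avoid roots, take a kernel vector `x` and an index `i` minimising `v
(x i) + d i / 2`: in row `i` the diagonal term then has strictly smaller order than all the others
and cannot cancel. -/
theorem AddValuation.det_ne_zero_of_dominant_diagonal {ι : Type*} [Fintype ι] [DecidableEq ι]
    (M : Matrix ι ι F) (d : ι → ℚ) (hdiag : ∀ i, v (M i i) = (d i : WithTop ℚ))
    (hoff : ∀ i j, i ≠ j → ∃ e : ℚ, (e : WithTop ℚ) ≤ v (M i j) ∧ (d i + d j) / 2 < e) :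
    M.det ≠ 0 := by
  intro hdet
  obtain ⟨x, hx0, hx⟩ := Matrix.exists_mulVec_eq_zero_iff.mpr hdet
  obtain ⟨k, hk⟩ := Function.ne_iff.mp hx0
  obtain ⟨i, -, hi⟩ := Finset.exists_min_image Finset.univ
    (fun i => v (x i) + ((d i / 2 : ℚ) : WithTop ℚ)) ⟨k, Finset.mem_univ k⟩
  have htop : ∀ j, x j ≠ 0 → ∃ q : ℚ, v (x j) = q := fun j hj =>
    ⟨_, (WithTop.coe_untop _ ((v.ne_top_iff).mpr hj)).symm⟩
  have hxi : x i ≠ 0 := by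
    intro h
    obtain ⟨q, hq⟩ := htop k hk
    have := hi k (Finset.mem_univ k)
    rw [h, v.map_zero, hq, WithTop.top_add, ← WithTop.coe_add] at this
    exact WithTop.coe_ne_top (top_le_iff.mp this)
  obtain ⟨q, hq⟩ := htop i hxi
  have hrow := congrFun hx i
  rw [Matrix.mulVec, dotProduct, Pi.zero_apply, ← Finset.add_sum_erase _ _ (Finset.mem_univ i),
    add_eq_zero_iff_eq_neg] at hrow
  have hlt : ((d i + q : ℚ) : WithTop ℚ) < v (∑ j ∈ Finset.univ.erase i, M i j * x j) := by
    refine v.map_lt_sum WithTop.coe_ne_top fun j hj => ?_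
    obtain ⟨e, he, hde⟩ := hoff i j (Finset.ne_of_mem_erase hj).symm
    rw [v.map_mul]
    by_cases hxj : x j = 0
    · rw [hxj, v.map_zero, WithTop.add_top]
      exact WithTop.coe_lt_top _
    · obtain ⟨r, hr⟩ := htop j hxj
      have := hi j (Finset.mem_univ j)
      rw [hq, hr, ← WithTop.coe_add, ← WithTop.coe_add, WithTop.coe_le_coe] at this
      refine lt_of_lt_of_le ?_ (add_le_add_left he (v (x j)))
      rw [hr, ← WithTop.coe_add, WithTop.coe_lt_coe]
      linarith
  rw [← v.map_neg, ← hrow, v.map_mul, hdiag, hq, ← WithTop.coe_add] at hlt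
  exact lt_irrefl _ hlt

variable {v}

/-- This and the next two bounds are explicit terms in the bounds of the parts, so that a bound for
any polynomial expression can be assembled by unification along its syntax. -/
theorem AddValuation.le_map_add_min {x y : F} {e f : ℚ} (hx : (e : WithTop ℚ) ≤ v x)
    (hy : (f : WithTop ℚ) ≤ v y) : ((min e f : ℚ) : WithTop ℚ) ≤ v (x + y) :=
  v.map_le_add (le_trans (WithTop.coe_le_coe.mpr (min_le_left e f)) hx)
    (le_trans (WithTop.coe_le_coe.mpr (min_le_right e f)) hy)

theorem AddValuation.le_map_mul_add {x y : F} {e f : ℚ} (hx : (e : WithTop ℚ) ≤ v x)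
    (hy : (f : WithTop ℚ) ≤ v y) : ((e + f : ℚ) : WithTop ℚ) ≤ v (x * y) := by
  rw [v.map_mul, WithTop.coe_add]
  exact add_le_add hx hy

theorem AddValuation.le_map_pow_mul {x : F} {e : ℚ} (hx : (e : WithTop ℚ) ≤ v x) (n : ℕ) :
    ((n * e : ℚ) : WithTop ℚ) ≤ v (x ^ n) := by
  induction n with
  | zero => simp
  | succ n ih =>
    rw [pow_succ, Nat.cast_succ, add_mul, one_mul]
    exact AddValuation.le_map_mul_add ih hx

theorem AddValuation.map_eq_of_leading {x y z : F} {d : ℚ} (hx : x = y + z)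
    (hy : v y = (d : WithTop ℚ)) (hz : ∃ e : ℚ, (e : WithTop ℚ) ≤ v z ∧ d < e) :
    v x = (d : WithTop ℚ) := by
  obtain ⟨e, hz, hde⟩ := hz
  rw [hx, ← hy]
  refine v.map_add_eq_of_lt_left ?_
  rw [hy]
  exact lt_of_lt_of_le (WithTop.coe_lt_coe.mpr hde) hz

theorem AddValuation.map_monomial {k x y : F} {e f : ℚ} (hk : v k = (0 : ℚ)) (hx : v x = e)
    (hy : v y = f) (p q : ℕ) : v (k * x ^ p * y ^ q) = ((p * e + q * f : ℚ) : WithTop ℚ) := by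
  rw [v.map_mul, v.map_mul, v.map_pow, v.map_pow, hk, hx, hy, WithTop.coe_zero, zero_add,
    ← WithTop.coe_nsmul, ← WithTop.coe_nsmul, ← WithTop.coe_add, nsmul_eq_mul, nsmul_eq_mul]

end Valuation

/-! ### Nonvanishing of the Gram determinants for `α < 1` and `α > 1`. -/

section GramDeterminant

variable {F : Type*} [Field F] {v : AddValuation F (WithTop ℚ)} {c t : F} {γ τ : ℚ}

theorem AddValuation.zero_le_map_ofNat (hnum : ∀ q : ℚ, q ≠ 0 → v (q : F) = (0 : ℚ)) (k : ℕ)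
    [k.AtLeastTwo] : ((0 : ℚ) : WithTop ℚ) ≤ v (ofNat(k) : F) := by
  have := hnum (OfNat.ofNat k) (by simp)
  rw [Rat.cast_ofNat] at this
  exact this.ge

theorem AddValuation.zero_le_map_half [CharZero F] (hnum : ∀ q : ℚ, q ≠ 0 → v (q : F) = (0 : ℚ)) :
    ((0 : ℚ) : WithTop ℚ) ≤ v (1 / 2 : F) := by
  have := hnum (1 / 2) (by norm_num)
  rw [show (((1 / 2 : ℚ) : ℚ) : F) = 1 / 2 by norm_num] at this
  exact this.ge

/-- A matrix with diagonal entries `k i * c ^ p i * t ^ q i + R i` is invertible when the monomials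
dominate the remainders `R i` and the entries off the diagonal. -/
theorem AddValuation.det_ne_zero_of_leading_monomials {ι : Type*} [Fintype ι] [DecidableEq ι]
    (hnum : ∀ q : ℚ, q ≠ 0 → v (q : F) = (0 : ℚ)) (hc : v c = (γ : WithTop ℚ))
    (ht : v t = (τ : WithTop ℚ)) (M : Matrix ι ι F) (k : ι → ℚ) (p q : ι → ℕ) (R : ι → F)
    (hk : ∀ i, k i ≠ 0) (hM : ∀ i, M i i = (k i : F) * c ^ p i * t ^ q i + R i)
    (hR : ∀ i, ∃ e : ℚ, (e : WithTop ℚ) ≤ v (R i) ∧ p i * γ + q i * τ < e)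
    (hoff : ∀ i j, i ≠ j → ∃ e : ℚ, (e : WithTop ℚ) ≤ v (M i j) ∧
      (p i * γ + q i * τ + (p j * γ + q j * τ)) / 2 < e) : M.det ≠ 0 :=
  v.det_ne_zero_of_dominant_diagonal M (fun i => p i * γ + q i * τ)
    (fun i => AddValuation.map_eq_of_leading (hM i)
      (AddValuation.map_monomial (hnum _ (hk i)) hc ht _ _) (hR i)) hoff

variable [CharZero F]

/-- Orders are minus the degrees in `c`, so here `c` dominates `t`. In this regime, at each level,
the leading diagonal monomial of a partition has a factor `c` for each part at least 2 and a factor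
`t` for each part 1. -/
theorem det_wordGram_words2_of_lt (hnum : ∀ q : ℚ, q ≠ 0 → v (q : F) = (0 : ℚ))
    (hc : v c = (γ : WithTop ℚ)) (ht : v t = (τ : WithTop ℚ)) (h : γ < τ) (hτ : τ < 0) :
    (wordGram c t words2).det ≠ 0 := by
  have hnat := fun (k : ℕ) [k.AtLeastTwo] => AddValuation.zero_le_map_ofNat hnum k
  have hhalf := AddValuation.zero_le_map_half hnum
  rw [wordGram_words2]
  refine AddValuation.det_ne_zero_of_leading_monomials hnum hc ht _ ![1/2, 8]
    ![1, 0] ![0, 2]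
    ![4*t, 4*t]
    (by simp [Fin.forall_fin_succ]) ?_ ?_ ?_
  · intro i
    fin_cases i <;> simp <;> ring
  · intro i
    fin_cases i <;>
    · simp only [Matrix.cons_val,
        Fin.zero_eta, Fin.mk_one, Fin.reduceFinMk]
      -- The bound `e` stays a metavariable, filled in by the structural lemmas; what remains are
      -- linear inequalities between exponents.
      apply Exists.intro
      constructor
      · with_reducible repeat first
          | exact hc.ge | exact ht.ge | exact hnat _ | exact hhalf
          | apply AddValuation.le_map_add_min | apply AddValuation.le_map_mul_add
          | apply AddValuation.le_map_pow_mul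
      · simp only [lt_min_iff, Nat.cast_ofNat, Nat.cast_one, Nat.cast_zero]
        (repeat' constructor) <;> linarith
  · intro i j hij
    fin_cases i <;> fin_cases j <;> first
      | exact absurd rfl hij
      | (simp only [Matrix.of_apply, Matrix.cons_val', Matrix.cons_val_fin_one, Matrix.cons_val,
          Fin.zero_eta, Fin.mk_one, Fin.reduceFinMk]
         apply Exists.intro
         constructor
         · with_reducible repeat first
             | exact hc.ge | exact ht.ge | exact hnat _
             | apply AddValuation.le_map_add_min | apply AddValuation.le_map_mul_add
             | apply AddValuation.le_map_pow_mul
         · simp only [lt_min_iff, Nat.cast_ofNat, Nat.cast_one, Nat.cast_zero]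
           (repeat' constructor) <;> linarith)

/-- Now `t` dominates `c`, and every part of the partition contributes one factor `t` to the leading
diagonal monomial. -/
theorem det_wordGram_words2_of_gt (hnum : ∀ q : ℚ, q ≠ 0 → v (q : F) = (0 : ℚ))
    (hc : v c = (γ : WithTop ℚ)) (ht : v t = (τ : WithTop ℚ)) (h : τ < γ) (hγ : γ < 0) :
    (wordGram c t words2).det ≠ 0 := by
  have hnat := fun (k : ℕ) [k.AtLeastTwo] => AddValuation.zero_le_map_ofNat hnum k
  have hhalf := AddValuation.zero_le_map_half hnum
  rw [wordGram_words2]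
  refine AddValuation.det_ne_zero_of_leading_monomials hnum hc ht _ ![4, 8]
    ![0, 0] ![1, 2]
    ![1/2*c, 4*t]
    (by simp [Fin.forall_fin_succ]) ?_ ?_ ?_
  · intro i
    fin_cases i <;> simp <;> ring
  · intro i
    fin_cases i <;>
    · simp only [Matrix.cons_val,
        Fin.zero_eta, Fin.mk_one, Fin.reduceFinMk]
      apply Exists.intro
      constructor
      · with_reducible repeat first
          | exact hc.ge | exact ht.ge | exact hnat _ | exact hhalf
          | apply AddValuation.le_map_add_min | apply AddValuation.le_map_mul_add
          | apply AddValuation.le_map_pow_mul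
      · simp only [lt_min_iff, Nat.cast_ofNat, Nat.cast_one, Nat.cast_zero]
        (repeat' constructor) <;> linarith
  · intro i j hij
    fin_cases i <;> fin_cases j <;> first
      | exact absurd rfl hij
      | (simp only [Matrix.of_apply, Matrix.cons_val', Matrix.cons_val_fin_one, Matrix.cons_val,
          Fin.zero_eta, Fin.mk_one, Fin.reduceFinMk]
         apply Exists.intro
         constructor
         · with_reducible repeat first
             | exact hc.ge | exact ht.ge | exact hnat _
             | apply AddValuation.le_map_add_min | apply AddValuation.le_map_mul_add
             | apply AddValuation.le_map_pow_mul
         · simp only [lt_min_iff, Nat.cast_ofNat, Nat.cast_one, Nat.cast_zero]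
           (repeat' constructor) <;> linarith)

set_option maxHeartbeats 4000000 in
theorem det_wordGram_words3_of_lt (hnum : ∀ q : ℚ, q ≠ 0 → v (q : F) = (0 : ℚ))
    (hc : v c = (γ : WithTop ℚ)) (ht : v t = (τ : WithTop ℚ)) (h : γ < τ) (hτ : τ < 0) :
    (wordGram c t words3).det ≠ 0 := by
  have hnat := fun (k : ℕ) [k.AtLeastTwo] => AddValuation.zero_le_map_ofNat hnum k
  have hhalf := AddValuation.zero_le_map_half hnum
  rw [wordGram_words3]
  refine AddValuation.det_ne_zero_of_leading_monomials hnum hc ht _ ![2, 1, 48]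
    ![1, 1, 0] ![0, 1, 3]
    ![6*t, 8*t^2 + 8*t, 72*t^2 + 24*t]
    (by simp [Fin.forall_fin_succ]) ?_ ?_ ?_
  · intro i
    fin_cases i <;> simp <;> ring
  · intro i
    fin_cases i <;>
    · simp only [Matrix.cons_val,
        Fin.zero_eta, Fin.mk_one, Fin.reduceFinMk]
      apply Exists.intro
      constructor
      · with_reducible repeat first
          | exact hc.ge | exact ht.ge | exact hnat _ | exact hhalf
          | apply AddValuation.le_map_add_min | apply AddValuation.le_map_mul_add
          | apply AddValuation.le_map_pow_mul
      · simp only [lt_min_iff, Nat.cast_ofNat, Nat.cast_one, Nat.cast_zero]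
        (repeat' constructor) <;> linarith
  · intro i j hij
    fin_cases i <;> fin_cases j <;> first
      | exact absurd rfl hij
      | (simp only [Matrix.of_apply, Matrix.cons_val', Matrix.cons_val_fin_one, Matrix.cons_val,
          Fin.zero_eta, Fin.mk_one, Fin.reduceFinMk]
         apply Exists.intro
         constructor
         · with_reducible repeat first
             | exact hc.ge | exact ht.ge | exact hnat _
             | apply AddValuation.le_map_add_min | apply AddValuation.le_map_mul_add
             | apply AddValuation.le_map_pow_mul
         · simp only [lt_min_iff, Nat.cast_ofNat, Nat.cast_one, Nat.cast_zero]
           (repeat' constructor) <;> linarith)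

set_option maxHeartbeats 4000000 in
theorem det_wordGram_words3_of_gt (hnum : ∀ q : ℚ, q ≠ 0 → v (q : F) = (0 : ℚ))
    (hc : v c = (γ : WithTop ℚ)) (ht : v t = (τ : WithTop ℚ)) (h : τ < γ) (hγ : γ < 0) :
    (wordGram c t words3).det ≠ 0 := by
  have hnat := fun (k : ℕ) [k.AtLeastTwo] => AddValuation.zero_le_map_ofNat hnum k
  have hhalf := AddValuation.zero_le_map_half hnum
  rw [wordGram_words3]
  refine AddValuation.det_ne_zero_of_leading_monomials hnum hc ht _ ![6, 8, 48]
    ![0, 0, 0] ![1, 2, 3]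
    ![2*c, c*t + 8*t, 72*t^2 + 24*t]
    (by simp [Fin.forall_fin_succ]) ?_ ?_ ?_
  · intro i
    fin_cases i <;> simp <;> ring
  · intro i
    fin_cases i <;>
    · simp only [Matrix.cons_val,
        Fin.zero_eta, Fin.mk_one, Fin.reduceFinMk]
      apply Exists.intro
      constructor
      · with_reducible repeat first
          | exact hc.ge | exact ht.ge | exact hnat _ | exact hhalf
          | apply AddValuation.le_map_add_min | apply AddValuation.le_map_mul_add
          | apply AddValuation.le_map_pow_mul
      · simp only [lt_min_iff, Nat.cast_ofNat, Nat.cast_one, Nat.cast_zero]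
        (repeat' constructor) <;> linarith
  · intro i j hij
    fin_cases i <;> fin_cases j <;> first
      | exact absurd rfl hij
      | (simp only [Matrix.of_apply, Matrix.cons_val', Matrix.cons_val_fin_one, Matrix.cons_val,
          Fin.zero_eta, Fin.mk_one, Fin.reduceFinMk]
         apply Exists.intro
         constructor
         · with_reducible repeat first
             | exact hc.ge | exact ht.ge | exact hnat _
             | apply AddValuation.le_map_add_min | apply AddValuation.le_map_mul_add
             | apply AddValuation.le_map_pow_mul
         · simp only [lt_min_iff, Nat.cast_ofNat, Nat.cast_one, Nat.cast_zero]
           (repeat' constructor) <;> linarith)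

set_option maxHeartbeats 4000000 in
theorem det_wordGram_words4_of_lt (hnum : ∀ q : ℚ, q ≠ 0 → v (q : F) = (0 : ℚ))
    (hc : v c = (γ : WithTop ℚ)) (ht : v t = (τ : WithTop ℚ)) (h : γ < τ) (hτ : τ < 0) :
    (wordGram c t words4).det ≠ 0 := by
  have hnat := fun (k : ℕ) [k.AtLeastTwo] => AddValuation.zero_le_map_ofNat hnum k
  have hhalf := AddValuation.zero_le_map_half hnum
  rw [wordGram_words4]
  refine AddValuation.det_ne_zero_of_leading_monomials hnum hc ht _ ![5, 4, 1/2, 4, 384]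
    ![1, 1, 2, 1, 0] ![0, 1, 0, 2, 4]
    ![8*t, 12*t^2 + 12*t, 8*c*t + 4*c + 32*t^2 + 32*t, 2*c*t + 32*t^3 + 116*t^2 + 32*t,
      1152*t^3 + 1056*t^2 + 288*t]
    (by simp [Fin.forall_fin_succ]) ?_ ?_ ?_
  · intro i
    fin_cases i <;> simp <;> ring
  · intro i
    fin_cases i <;>
    · simp only [Matrix.cons_val,
        Fin.zero_eta, Fin.mk_one, Fin.reduceFinMk]
      apply Exists.intro
      constructor
      · with_reducible repeat first
          | exact hc.ge | exact ht.ge | exact hnat _ | exact hhalf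
          | apply AddValuation.le_map_add_min | apply AddValuation.le_map_mul_add
          | apply AddValuation.le_map_pow_mul
      · simp only [lt_min_iff, Nat.cast_ofNat, Nat.cast_one, Nat.cast_zero]
        (repeat' constructor) <;> linarith
  · intro i j hij
    fin_cases i <;> fin_cases j <;> first
      | exact absurd rfl hij
      | (simp only [Matrix.of_apply, Matrix.cons_val', Matrix.cons_val_fin_one, Matrix.cons_val,
          Fin.zero_eta, Fin.mk_one, Fin.reduceFinMk]
         apply Exists.intro
         constructor
         · with_reducible repeat first
             | exact hc.ge | exact ht.ge | exact hnat _
             | apply AddValuation.le_map_add_min | apply AddValuation.le_map_mul_add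
             | apply AddValuation.le_map_pow_mul
         · simp only [lt_min_iff, Nat.cast_ofNat, Nat.cast_one, Nat.cast_zero]
           (repeat' constructor) <;> linarith)

set_option maxHeartbeats 4000000 in
theorem det_wordGram_words4_of_gt (hnum : ∀ q : ℚ, q ≠ 0 → v (q : F) = (0 : ℚ))
    (hc : v c = (γ : WithTop ℚ)) (ht : v t = (τ : WithTop ℚ)) (h : τ < γ) (hγ : γ < 0) :
    (wordGram c t words4).det ≠ 0 := by
  have hnat := fun (k : ℕ) [k.AtLeastTwo] => AddValuation.zero_le_map_ofNat hnum k
  have hhalf := AddValuation.zero_le_map_half hnum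
  rw [wordGram_words4]
  refine AddValuation.det_ne_zero_of_leading_monomials hnum hc ht _ ![8, 12, 32, 32, 384]
    ![0, 0, 0, 0, 0] ![1, 2, 2, 3, 4]
    ![5*c, 4*c*t + 12*t, 1/2*c^2 + 8*c*t + 4*c + 32*t, 4*c*t^2 + 2*c*t + 116*t^2 + 32*t,
      1152*t^3 + 1056*t^2 + 288*t]
    (by simp [Fin.forall_fin_succ]) ?_ ?_ ?_
  · intro i
    fin_cases i <;> simp <;> ring
  · intro i
    fin_cases i <;>
    · simp only [Matrix.cons_val,
        Fin.zero_eta, Fin.mk_one, Fin.reduceFinMk]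
      apply Exists.intro
      constructor
      · with_reducible repeat first
          | exact hc.ge | exact ht.ge | exact hnat _ | exact hhalf
          | apply AddValuation.le_map_add_min | apply AddValuation.le_map_mul_add
          | apply AddValuation.le_map_pow_mul
      · simp only [lt_min_iff, Nat.cast_ofNat, Nat.cast_one, Nat.cast_zero]
        (repeat' constructor) <;> linarith
  · intro i j hij
    fin_cases i <;> fin_cases j <;> first
      | exact absurd rfl hij
      | (simp only [Matrix.of_apply, Matrix.cons_val', Matrix.cons_val_fin_one, Matrix.cons_val,
          Fin.zero_eta, Fin.mk_one, Fin.reduceFinMk]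
         apply Exists.intro
         constructor
         · with_reducible repeat first
             | exact hc.ge | exact ht.ge | exact hnat _
             | apply AddValuation.le_map_add_min | apply AddValuation.le_map_mul_add
             | apply AddValuation.le_map_pow_mul
         · simp only [lt_min_iff, Nat.cast_ofNat, Nat.cast_one, Nat.cast_zero]
           (repeat' constructor) <;> linarith)

set_option maxHeartbeats 4000000 in
theorem det_wordGram_words5_of_lt (hnum : ∀ q : ℚ, q ≠ 0 → v (q : F) = (0 : ℚ))
    (hc : v c = (γ : WithTop ℚ)) (ht : v t = (τ : WithTop ℚ)) (h : γ < τ) (hτ : τ < 0) :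
    (wordGram c t words5).det ≠ 0 := by
  have hnat := fun (k : ℕ) [k.AtLeastTwo] => AddValuation.zero_le_map_ofNat hnum k
  have hhalf := AddValuation.zero_le_map_half hnum
  rw [wordGram_words5]
  refine AddValuation.det_ne_zero_of_leading_monomials hnum hc ht _ ![10, 10, 1, 16, 1, 24, 3840]
    ![1, 1, 2, 1, 2, 1, 0] ![0, 1, 0, 2, 1, 3, 5]
    ![10*t, 16*t^2 + 16*t, 11*c*t + 6*c + 24*t^2 + 48*t, 8*c*t + 48*t^3 + 120*t^2 + 48*t,
      16*c*t^2 + 24*c*t + 64*t^3 + 192*t^2 + 128*t,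
      36*c*t^2 + 12*c*t + 192*t^4 + 1512*t^3 + 1392*t^2 + 360*t,
      19200*t^4 + 33600*t^3 + 24000*t^2 + 5760*t]
    (by simp [Fin.forall_fin_succ]) ?_ ?_ ?_
  · intro i
    fin_cases i <;> simp <;> ring
  · intro i
    fin_cases i <;>
    · simp only [Matrix.cons_val,
        Fin.zero_eta, Fin.mk_one, Fin.reduceFinMk]
      apply Exists.intro
      constructor
      · with_reducible repeat first
          | exact hc.ge | exact ht.ge | exact hnat _ | exact hhalf
          | apply AddValuation.le_map_add_min | apply AddValuation.le_map_mul_add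
          | apply AddValuation.le_map_pow_mul
      · simp only [lt_min_iff, Nat.cast_ofNat, Nat.cast_one, Nat.cast_zero]
        (repeat' constructor) <;> linarith
  · intro i j hij
    fin_cases i <;> fin_cases j <;> first
      | exact absurd rfl hij
      | (simp only [Matrix.of_apply, Matrix.cons_val', Matrix.cons_val_fin_one, Matrix.cons_val,
          Fin.zero_eta, Fin.mk_one, Fin.reduceFinMk]
         apply Exists.intro
         constructor
         · with_reducible repeat first
             | exact hc.ge | exact ht.ge | exact hnat _
             | apply AddValuation.le_map_add_min | apply AddValuation.le_map_mul_add
             | apply AddValuation.le_map_pow_mul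
         · simp only [lt_min_iff, Nat.cast_ofNat, Nat.cast_one, Nat.cast_zero]
           (repeat' constructor) <;> linarith)

set_option maxHeartbeats 4000000 in
theorem det_wordGram_words5_of_gt (hnum : ∀ q : ℚ, q ≠ 0 → v (q : F) = (0 : ℚ))
    (hc : v c = (γ : WithTop ℚ)) (ht : v t = (τ : WithTop ℚ)) (h : τ < γ) (hγ : γ < 0) :
    (wordGram c t words5).det ≠ 0 := by
  have hnat := fun (k : ℕ) [k.AtLeastTwo] => AddValuation.zero_le_map_ofNat hnum k
  have hhalf := AddValuation.zero_le_map_half hnum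
  rw [wordGram_words5]
  refine AddValuation.det_ne_zero_of_leading_monomials hnum hc ht _ ![10, 16, 24, 48, 64, 192, 3840]
    ![0, 0, 0, 0, 0, 0, 0] ![1, 2, 2, 3, 3, 4, 5]
    ![10*c, 10*c*t + 16*t, c^2 + 11*c*t + 6*c + 48*t, 16*c*t^2 + 8*c*t + 120*t^2 + 48*t,
      c^2*t + 16*c*t^2 + 24*c*t + 192*t^2 + 128*t,
      24*c*t^3 + 36*c*t^2 + 12*c*t + 1512*t^3 + 1392*t^2 + 360*t,
      19200*t^4 + 33600*t^3 + 24000*t^2 + 5760*t]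
    (by simp [Fin.forall_fin_succ]) ?_ ?_ ?_
  · intro i
    fin_cases i <;> simp <;> ring
  · intro i
    fin_cases i <;>
    · simp only [Matrix.cons_val,
        Fin.zero_eta, Fin.mk_one, Fin.reduceFinMk]
      apply Exists.intro
      constructor
      · with_reducible repeat first
          | exact hc.ge | exact ht.ge | exact hnat _ | exact hhalf
          | apply AddValuation.le_map_add_min | apply AddValuation.le_map_mul_add
          | apply AddValuation.le_map_pow_mul
      · simp only [lt_min_iff, Nat.cast_ofNat, Nat.cast_one, Nat.cast_zero]
        (repeat' constructor) <;> linarith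
  · intro i j hij
    fin_cases i <;> fin_cases j <;> first
      | exact absurd rfl hij
      | (simp only [Matrix.of_apply, Matrix.cons_val', Matrix.cons_val_fin_one, Matrix.cons_val,
          Fin.zero_eta, Fin.mk_one, Fin.reduceFinMk]
         apply Exists.intro
         constructor
         · with_reducible repeat first
             | exact hc.ge | exact ht.ge | exact hnat _
             | apply AddValuation.le_map_add_min | apply AddValuation.le_map_mul_add
             | apply AddValuation.le_map_pow_mul
         · simp only [lt_min_iff, Nat.cast_ofNat, Nat.cast_one, Nat.cast_zero]
           (repeat' constructor) <;> linarith)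

end GramDeterminant

/-! ### Calculus of expansions `f(u) + b v` modulo order greater than `α`. -/

section FirstOrder

open HahnSeries

variable {K : Type*} [Field K]

theorem zero_le_addVal_heval (u : HahnSeries ℚ K) (hu : 0 < u.orderTop) (f : K⟦X⟧) :
    0 ≤ addVal ℚ K (PowerSeries.heval u f) := by
  rw [addVal_apply, le_orderTop_iff_forall]
  intro e he
  rw [PowerSeries.coeff_heval]
  refine finsum_eq_zero_of_forall_eq_zero fun n => ?_
  simp only [SummableFamily.coeff_apply, SummableFamily.smulFamily_toFun, HahnSeries.coeff_smul,
    smul_eq_mul]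
  refine mul_eq_zero_of_right _ (coeff_eq_zero_of_lt_orderTop (lt_of_lt_of_le he ?_))
  rw [SummableFamily.powers_of_orderTop_pos hu, ← addVal_apply, AddValuation.map_pow, addVal_apply]
  exact nsmul_nonneg hu.le n

theorem zero_lt_addVal_heval_sub (u : HahnSeries ℚ K) (hu : 0 < u.orderTop) (f : K⟦X⟧) :
    0 < addVal ℚ K (PowerSeries.heval u f - HahnSeries.C (PowerSeries.constantCoeff f)) := by
  obtain ⟨g, hg⟩ := PowerSeries.X_dvd_iff.mpr
    (show PowerSeries.constantCoeff (f - PowerSeries.C (PowerSeries.constantCoeff f)) = 0 by simp)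
  have h : PowerSeries.heval u f - HahnSeries.C (PowerSeries.constantCoeff f) =
      u * PowerSeries.heval u g := by
    have := congrArg (PowerSeries.heval u) hg
    rw [map_sub, map_mul, PowerSeries.heval_X u hu, PowerSeries.heval_C] at this
    rw [← this]
    congr 1
    ext e
    by_cases he : e = 0 <;> simp [he, HahnSeries.C_apply, HahnSeries.coeff_single, HahnSeries.coeff_one]
  rw [h, AddValuation.map_mul]
  exact add_pos_of_pos_of_nonneg (by rwa [addVal_apply]) (zero_le_addVal_heval u hu g)

/-- `x` agrees with `f(u) + b v` up to terms of order greater than `α`. -/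
def FirstOrder (α : ℚ) (u v x : HahnSeries ℚ K) (f : K⟦X⟧) (b : K) : Prop :=
  (α : WithTop ℚ) < addVal ℚ K (x - (PowerSeries.heval u f + HahnSeries.C b * v))

variable {α : ℚ} {u v x y : HahnSeries ℚ K} {f g : K⟦X⟧} {b b' : K}

theorem zero_le_addVal_C (b : K) : 0 ≤ addVal ℚ K (HahnSeries.C b) := by
  rw [addVal_apply, HahnSeries.C_apply]
  exact orderTop_single_le

theorem FirstOrder.add (hx : FirstOrder α u v x f b) (hy : FirstOrder α u v y g b') :
    FirstOrder α u v (x + y) (f + g) (b + b') := by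
  have := (addVal ℚ K).map_lt_add hx hy
  unfold FirstOrder
  convert this using 2
  simp only [map_add]
  ring

/-- As `v` has order at least `α > 0` and `u` has positive order, `u v` and `v²` are negligible, so
`v` multiplies only constant terms. -/
theorem FirstOrder.mul (hα : 0 < α) (hu : 0 < u.orderTop) (hv : (α : WithTop ℚ) ≤ addVal ℚ K v)
    (hx : FirstOrder α u v x f b) (hy : FirstOrder α u v y g b') :
    FirstOrder α u v (x * y) (f * g)
      (PowerSeries.constantCoeff f * b' + b * PowerSeries.constantCoeff g) := by
  have hα' : (0 : WithTop ℚ) < α := by exact_mod_cast hα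
  have key : ∀ (f : K⟦X⟧) (b : K), 0 ≤ addVal ℚ K (PowerSeries.heval u f + HahnSeries.C b * v) := by
    intro f b
    refine AddValuation.map_le_add _ (zero_le_addVal_heval u hu f) ?_
    rw [AddValuation.map_mul]
    exact add_nonneg (zero_le_addVal_C b) (hα'.le.trans hv)
  have hsmall : ∀ (f : K⟦X⟧) (b : K), (α : WithTop ℚ) < addVal ℚ K
      ((PowerSeries.heval u f - HahnSeries.C (PowerSeries.constantCoeff f)) * (HahnSeries.C b * v)) := by
    intro f b
    have h1 : (α : WithTop ℚ) ≤ addVal ℚ K (HahnSeries.C b * v) := by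
      rw [AddValuation.map_mul]
      exact le_add_of_nonneg_of_le (zero_le_addVal_C b) hv
    rw [AddValuation.map_mul]
    have h2 := zero_lt_addVal_heval_sub u hu f
    calc (α : WithTop ℚ) = 0 + α := (zero_add _).symm
      _ < addVal ℚ K (PowerSeries.heval u f - HahnSeries.C (PowerSeries.constantCoeff f)) + α :=
        WithTop.add_lt_add_right WithTop.coe_ne_top h2
      _ ≤ _ := add_le_add_right h1 _
  have hprod : ∀ z w : HahnSeries ℚ K, 0 ≤ addVal ℚ K z → (α : WithTop ℚ) < addVal ℚ K w →
      (α : WithTop ℚ) < addVal ℚ K (z * w) := by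
    intro z w hz hw
    rw [AddValuation.map_mul]
    exact lt_add_of_nonneg_of_lt hz hw
  have hvv : (α : WithTop ℚ) < addVal ℚ K (HahnSeries.C b * v * (HahnSeries.C b' * v)) := by
    rw [mul_mul_mul_comm]
    refine hprod _ _ ?_ ?_
    · rw [AddValuation.map_mul]
      exact add_nonneg (zero_le_addVal_C b) (zero_le_addVal_C b')
    · rw [AddValuation.map_mul]
      calc (α : WithTop ℚ) = 0 + α := (zero_add _).symm
        _ < (α : WithTop ℚ) + α := WithTop.add_lt_add_right WithTop.coe_ne_top hα'
        _ ≤ _ := add_le_add hv hv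
  have h1 := hprod _ _ (key f b) hy
  have h2 := hprod _ _ (key g b') hx
  have h3 := hprod _ _ (hα'.le.trans hx.le) hy
  -- With `P`, `Q` the truncations of `x`, `y`, the error is `P (y - Q) + Q (x - P) + (x - P)(y -
  -- Q)` plus the three negligible terms of `P Q`: the `v²` term and the two products of `v` with a
  -- non-constant part.
  have := (addVal ℚ K).map_lt_add (AddValuation.map_lt_add _ (AddValuation.map_lt_add _ h1 h2)
    (AddValuation.map_lt_add _ h3 hvv)) (AddValuation.map_lt_add _ (hsmall f b') (hsmall g b))
  unfold FirstOrder
  convert this using 2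
  simp only [map_add, map_mul]
  ring

theorem firstOrder_C (k : K) : FirstOrder α u v (HahnSeries.C k) (PowerSeries.C k) 0 := by
  unfold FirstOrder
  have : PowerSeries.heval u (PowerSeries.C k) = HahnSeries.C k := by
    rw [PowerSeries.heval_C]
    ext e
    by_cases he : e = 0 <;> simp [he, HahnSeries.C_apply, HahnSeries.coeff_single, HahnSeries.coeff_one]
  rw [this]
  simp

theorem firstOrder_u (hu : 0 < u.orderTop) : FirstOrder α u v u PowerSeries.X 0 := by
  unfold FirstOrder
  rw [PowerSeries.heval_X u hu]
  simp

theorem firstOrder_v : FirstOrder α u v v 0 1 := by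
  unfold FirstOrder
  rw [map_zero]
  simp

/-- The candidate `y` satisfies `x y = 1` up to order greater than `α` by the product rule. Since
`x` has order 0, dividing by it loses no precision. -/
theorem FirstOrder.inv (hα : 0 < α) (hu : 0 < u.orderTop) (hv : (α : WithTop ℚ) ≤ addVal ℚ K v)
    (hx : FirstOrder α u v x f b) (hf : PowerSeries.constantCoeff f ≠ 0) :
    FirstOrder α u v x⁻¹ f⁻¹ (-b / PowerSeries.constantCoeff f ^ 2) := by
  have hα' : (0 : WithTop ℚ) < α := by exact_mod_cast hα
  set y := PowerSeries.heval u f⁻¹ + HahnSeries.C (-b / PowerSeries.constantCoeff f ^ 2) * v with hy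
  have hy' : FirstOrder α u v y f⁻¹ (-b / PowerSeries.constantCoeff f ^ 2) := by
    unfold FirstOrder
    simp [hy]
  have hxy := FirstOrder.mul hα hu hv hx hy'
  have hb : PowerSeries.constantCoeff f * (-b / PowerSeries.constantCoeff f ^ 2)
      + b * PowerSeries.constantCoeff f⁻¹ = 0 := by
    rw [PowerSeries.constantCoeff_inv]
    field_simp
    ring
  unfold FirstOrder at hxy
  rw [hb, PowerSeries.mul_inv_cancel f hf, map_one, map_zero, zero_mul, add_zero] at hxy
  have hval : addVal ℚ K x = 0 := by
    have h0 : addVal ℚ K (HahnSeries.C (PowerSeries.constantCoeff f)) = (0 : ℚ) := by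
      rw [addVal_apply, HahnSeries.C_apply, orderTop_single hf]
    have h1 : 0 < addVal ℚ K (x - HahnSeries.C (PowerSeries.constantCoeff f)) := by
      have h2 : 0 < addVal ℚ K (HahnSeries.C b * v) := by
        rw [AddValuation.map_mul]
        exact lt_of_lt_of_le hα' (le_add_of_nonneg_of_le (zero_le_addVal_C b) hv)
      have := (addVal ℚ K).map_lt_add (AddValuation.map_lt_add _ (hα'.trans hx)
        (zero_lt_addVal_heval_sub u hu f)) h2
      convert this using 2
      ring
    have := (addVal ℚ K).map_add_eq_of_lt_left (h0.trans_lt h1)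
    rwa [add_sub_cancel, h0] at this
  have hx0 : x ≠ 0 := by
    rintro rfl
    rw [AddValuation.map_zero] at hval
    exact WithTop.top_ne_zero hval
  unfold FirstOrder
  rw [← hy]
  have : x⁻¹ - y = -(x⁻¹ * (x * y - 1)) := by
    field_simp
    ring
  rw [this, AddValuation.map_neg, AddValuation.map_mul]
  have hinv : addVal ℚ K x⁻¹ = 0 := by
    have := (addVal ℚ K).map_mul x x⁻¹
    rw [mul_inv_cancel₀ hx0, AddValuation.map_one, hval, zero_add] at this
    exact this.symm
  rwa [hinv, zero_add]

end FirstOrder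

/-! ### Coefficients of the logarithm and their homogeneity. -/

section LogCoefficients

/-- The numerator of the scaled second logarithmic coefficient. -/
def logNum2 {R : Type*} [CommRing R] (a b κ v : R) : R :=
  3*a + 2*a*v + 26*b + 16*b*κ - 16*b*v + 32*b*κ^2 - 16*b*κ*v + 16*b*κ^2*v

set_option maxHeartbeats 4000000 in
/-- The numerator of the scaled fourth logarithmic coefficient. -/
def logNum4 {R : Type*} [CommRing R] (a b κ v : R) : R :=
  175*a^4 + 510*a^4*v + 450*a^4*v^2 + 120*a^4*v^3 + 4762*a^3*b + 2272*a^3*b*κ + 7731*a^3*b*v +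
  4608*a^3*b*κ^2 + 2240*a^3*b*κ*v + 1390*a^3*b*v^2 + 11520*a^3*b*κ^2*v - 2784*a^3*b*κ*v^2 -
  486*a^3*b*v^3 + 8064*a^3*b*κ^2*v^2 - 1728*a^3*b*κ*v^3 + 408*a^3*b*v^4 + 1728*a^3*b*κ^2*v^3 +
  45352*a^2*b^2 + 40768*a^2*b^2*κ + 6018*a^2*b^2*v + 83840*a^2*b^2*κ^2 - 7360*a^2*b^2*κ*v -
  20958*a^2*b^2*v^2 + 2048*a^2*b^2*κ^3 + 112128*a^2*b^2*κ^2*v - 36160*a^2*b^2*κ*v^2 +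
  13696*a^2*b^2*v^3 + 5120*a^2*b^2*κ^3*v + 24512*a^2*b^2*κ^2*v^2 + 8704*a^2*b^2*κ*v^3 -
  3420*a^2*b^2*v^4 + 3584*a^2*b^2*κ^3*v^2 + 8768*a^2*b^2*κ^2*v^3 - 5952*a^2*b^2*κ*v^4 -
  528*a^2*b^2*v^5 + 768*a^2*b^2*κ^3*v^3 + 5952*a^2*b^2*κ^2*v^4 + 169128*a*b^3 + 208512*a*b^3*κ -
  325692*a*b^3*v + 423680*a*b^3*κ^2 - 411136*a*b^3*κ*v + 226928*a*b^3*v^2 - 22528*a*b^3*κ^3 -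
  186496*a*b^3*κ^2*v + 328128*a*b^3*κ*v^2 + 11608*a*b^3*v^3 - 22528*a*b^3*κ^4 - 49152*a*b^3*κ^3*v +
  47616*a*b^3*κ^2*v^2 - 128896*a*b^3*κ*v^3 - 55472*a*b^3*v^4 - 56320*a*b^3*κ^4*v +
  73728*a*b^3*κ^3*v^2 + 109696*a*b^3*κ^2*v^3 - 4288*a*b^3*κ*v^4 + 8640*a*b^3*v^5 -
  39424*a*b^3*κ^4*v^2 + 10240*a*b^3*κ^3*v^3 - 18176*a*b^3*κ^2*v^4 + 7680*a*b^3*κ*v^5 -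
  8448*a*b^3*κ^4*v^3 - 768*a*b^3*κ^3*v^4 - 7680*a*b^3*κ^2*v^5 + 172864*b^4 + 238592*b^4*κ -
  1119880*b^4*v + 481280*b^4*κ^2 - 1641088*b^4*κ*v + 2003816*b^4*v^2 - 49152*b^4*κ^3 -
  2552576*b^4*κ^2*v + 3322368*b^4*κ*v^2 - 1443328*b^4*v^3 + 81920*b^4*κ^4 - 43008*b^4*κ^3*v +
  2433664*b^4*κ^2*v^2 - 2753408*b^4*κ*v^3 + 420128*b^4*v^4 + 325632*b^4*κ^4*v + 15360*b^4*κ^3*v^2 +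
  241920*b^4*κ^2*v^3 + 910336*b^4*κ*v^4 - 33600*b^4*v^5 - 356352*b^4*κ^4*v^2 + 62976*b^4*κ^3*v^3 -
  677248*b^4*κ^2*v^4 - 76800*b^4*κ*v^5 - 25088*b^4*κ^4*v^3 - 9216*b^4*κ^3*v^4 + 76800*b^4*κ^2*v^5 +
  8448*b^4*κ^4*v^4

/-- The numerator of the second logarithmic coefficient. -/
def logPoly2 {R : Type*} [CommRing R] (h t c : R) : R :=
  3*c*t^2 + 2*c*t + 26*t^3 + 16*t^2*h - 16*t^2 + 32*t*h^2 - 16*t*h + 16*h^2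

set_option maxHeartbeats 4000000 in
/-- The numerator of the fourth logarithmic coefficient. -/
def logPoly4 {R : Type*} [CommRing R] (h t c : R) : R :=
  175*c^4*t^4 + 510*c^4*t^3 + 450*c^4*t^2 + 120*c^4*t + 4762*c^3*t^5 + 2272*c^3*t^4*h +
  7731*c^3*t^4 + 4608*c^3*t^3*h^2 + 2240*c^3*t^3*h + 1390*c^3*t^3 + 11520*c^3*t^2*h^2 -
  2784*c^3*t^2*h - 486*c^3*t^2 + 8064*c^3*t*h^2 - 1728*c^3*t*h + 408*c^3*t + 1728*c^3*h^2 +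
  45352*c^2*t^6 + 40768*c^2*t^5*h + 6018*c^2*t^5 + 83840*c^2*t^4*h^2 - 7360*c^2*t^4*h -
  20958*c^2*t^4 + 2048*c^2*t^3*h^3 + 112128*c^2*t^3*h^2 - 36160*c^2*t^3*h + 13696*c^2*t^3 +
  5120*c^2*t^2*h^3 + 24512*c^2*t^2*h^2 + 8704*c^2*t^2*h - 3420*c^2*t^2 + 3584*c^2*t*h^3 +
  8768*c^2*t*h^2 - 5952*c^2*t*h - 528*c^2*t + 768*c^2*h^3 + 5952*c^2*h^2 + 169128*c*t^7 +
  208512*c*t^6*h - 325692*c*t^6 + 423680*c*t^5*h^2 - 411136*c*t^5*h + 226928*c*t^5 -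
  22528*c*t^4*h^3 - 186496*c*t^4*h^2 + 328128*c*t^4*h + 11608*c*t^4 - 22528*c*t^3*h^4 -
  49152*c*t^3*h^3 + 47616*c*t^3*h^2 - 128896*c*t^3*h - 55472*c*t^3 - 56320*c*t^2*h^4 +
  73728*c*t^2*h^3 + 109696*c*t^2*h^2 - 4288*c*t^2*h + 8640*c*t^2 - 39424*c*t*h^4 + 10240*c*t*h^3 -
  18176*c*t*h^2 + 7680*c*t*h - 8448*c*h^4 - 768*c*h^3 - 7680*c*h^2 + 172864*t^8 + 238592*t^7*h -
  1119880*t^7 + 481280*t^6*h^2 - 1641088*t^6*h + 2003816*t^6 - 49152*t^5*h^3 - 2552576*t^5*h^2 +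
  3322368*t^5*h - 1443328*t^5 + 81920*t^4*h^4 - 43008*t^4*h^3 + 2433664*t^4*h^2 - 2753408*t^4*h +
  420128*t^4 + 325632*t^3*h^4 + 15360*t^3*h^3 + 241920*t^3*h^2 + 910336*t^3*h - 33600*t^3 -
  356352*t^2*h^4 + 62976*t^2*h^3 - 677248*t^2*h^2 - 76800*t^2*h - 25088*t*h^4 - 9216*t*h^3 +
  76800*t*h^2 + 8448*h^4

/-- The scaled form of `kac2`. -/
def scaledKac2 {R : Type*} [CommRing R] (a b v : R) : R := 16 * b + 2 * a - 10 * b * v + a * v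

/-- The scaled form of `kac4`. -/
def scaledKac4 {R : Type*} [CommRing R] (a b v : R) : R :=
  (a + 8 * b - b * v) * (20 * a + 30 * a * v + 32 * b - 164 * b * v + 132 * b * v ^ 2)

section PowerSeriesLog

variable {L : Type*} [Field L] [Algebra ℚ L]

theorem PowerSeries.mul_derivative_logOf (f : L⟦X⟧) (hf : PowerSeries.constantCoeff f = 1) :
    f * PowerSeries.derivative L (PowerSeries.logOf f) = PowerSeries.derivative L f := by
  have hs : PowerSeries.HasSubst (f - 1) :=
    PowerSeries.HasSubst.of_constantCoeff_zero' (by simp [hf])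
  rw [PowerSeries.logOf_eq, PowerSeries.derivative_subst hs, PowerSeries.deriv_log, ← mul_assoc]
  have h1 : (PowerSeries.mk fun n => algebraMap ℚ L ((-1 : ℚ) ^ n)) * (1 + PowerSeries.X) = 1 := by
    rw [mul_add, mul_one]
    ext n
    cases n with
    | zero => simp
    | succ n => simp [PowerSeries.coeff_succ_mul_X, PowerSeries.coeff_one, pow_succ]
  have h2 := congrArg (PowerSeries.substAlgHom (R := L) hs) h1
  rw [map_mul, map_one, map_add, map_one, PowerSeries.substAlgHom_X, add_sub_cancel,
    PowerSeries.coe_substAlgHom] at h2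
  rw [mul_comm f, h2, one_mul, map_sub]
  simp

theorem PowerSeries.coeff_logOf_recursion (f : L⟦X⟧) (hf : PowerSeries.constantCoeff f = 1) (n : ℕ) :
    ∑ p ∈ Finset.HasAntidiagonal.antidiagonal n, PowerSeries.coeff p.1 f *
      (PowerSeries.coeff (p.2 + 1) (PowerSeries.logOf f) * (p.2 + 1)) =
        PowerSeries.coeff (n + 1) f * (n + 1) := by
  have := congrArg (PowerSeries.coeff n) (PowerSeries.mul_derivative_logOf f hf)
  rw [PowerSeries.coeff_mul, PowerSeries.coeff_derivative] at this
  simpa only [PowerSeries.coeff_derivative] using this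

end PowerSeriesLog

variable {L : Type*} [Field L] [CharZero L] [Algebra ℚ L]

theorem coeff_logBlock_zero (h t c : L) : PowerSeries.coeff 0 (logBlock h t c) = 0 := by
  rw [PowerSeries.coeff_zero_eq_constantCoeff_apply]
  refine PowerSeries.constantCoeff_logOf ?_
  rw [← PowerSeries.coeff_zero_eq_constantCoeff_apply, virBlock, PowerSeries.coeff_mk,
    blockCoeff_zero]

/-- The logarithmic coefficients in terms of the even block coefficients. -/
theorem coeff_logBlock (h t c : L) (ht : t ≠ 0) (hdet2 : (wordGram c t words2).det ≠ 0)
    (hdet3 : (wordGram c t words3).det ≠ 0) (hdet4 : (wordGram c t words4).det ≠ 0)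
    (hdet5 : (wordGram c t words5).det ≠ 0) :
    PowerSeries.coeff 1 (logBlock h t c) = t / 2 ∧
    PowerSeries.coeff 2 (logBlock h t c) = blockCoeff h t c 2 - t ^ 2 / 8 ∧
    PowerSeries.coeff 3 (logBlock h t c) = PowerSeries.coeff 2 (logBlock h t c) - t / 12 ∧
    PowerSeries.coeff 4 (logBlock h t c) = blockCoeff h t c 4
      - t / 2 * ((t + 2) / 2 * blockCoeff h t c 2 - t * (t + 1) * (t + 2) / 24)
      - blockCoeff h t c 2 ^ 2 / 2 + t ^ 2 / 4 * blockCoeff h t c 2 - t ^ 4 / 64 ∧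
    PowerSeries.coeff 5 (logBlock h t c) = 2 * PowerSeries.coeff 4 (logBlock h t c)
      - PowerSeries.coeff 2 (logBlock h t c) + t / 10 := by
  have hrec := PowerSeries.coeff_logOf_recursion (virBlock h t c) (by
    rw [← PowerSeries.coeff_zero_eq_constantCoeff_apply, virBlock, PowerSeries.coeff_mk,
      blockCoeff_zero])
  simp only [virBlock, PowerSeries.coeff_mk] at hrec
  have r0 := hrec 0
  have r1 := hrec 1
  have r2 := hrec 2
  have r3 := hrec 3
  have r4 := hrec 4
  clear hrec
  simp only [Finset.Nat.antidiagonal_succ, Finset.Nat.antidiagonal_zero, Finset.sum_cons,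
    Finset.map_cons, Finset.map_singleton, Finset.sum_singleton, Function.Embedding.prodMap,
    Function.Embedding.coeFn_mk, Prod.map_apply, Nat.succ_eq_add_one, Function.Embedding.refl_apply,
    zero_add, Nat.reduceAdd, blockCoeff_zero, blockCoeff_one h t c ht,
    blockCoeff_three h t c hdet2 hdet3, blockCoeff_five h t c hdet2 hdet4 hdet5, Nat.cast_zero,
    Nat.cast_one, Nat.cast_ofNat] at r0 r1 r2 r3 r4
  simp only [logBlock, virBlock]
  generalize PowerSeries.coeff 1 (PowerSeries.mk (blockCoeff h t c)).logOf = g1 at *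
  generalize PowerSeries.coeff 2 (PowerSeries.mk (blockCoeff h t c)).logOf = g2 at *
  generalize PowerSeries.coeff 3 (PowerSeries.mk (blockCoeff h t c)).logOf = g3 at *
  generalize PowerSeries.coeff 4 (PowerSeries.mk (blockCoeff h t c)).logOf = g4 at *
  generalize PowerSeries.coeff 5 (PowerSeries.mk (blockCoeff h t c)).logOf = g5 at *
  generalize blockCoeff h t c 2 = F2 at *
  generalize blockCoeff h t c 4 = F4 at *
  have h1 : g1 = t / 2 := by linear_combination r0
  subst h1
  have h2 : g2 = F2 - t ^ 2 / 8 := by linear_combination r1 / 2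
  subst h2
  have h3 : g3 = F2 - t ^ 2 / 8 - t / 12 := by linear_combination r2 / 3
  subst h3
  have h4 : g4 = F4 - t / 2 * ((t + 2) / 2 * F2 - t * (t + 1) * (t + 2) / 24) - F2 ^ 2 / 2
      + t ^ 2 / 4 * F2 - t ^ 4 / 64 := by linear_combination r3 / 4
  subst h4
  refine ⟨rfl, rfl, rfl, rfl, ?_⟩
  -- The relations for the odd coefficients reflect that `log F + (t / 2) log(1 - z)` is invariant
  -- under `z ↦ z / (z - 1)`.
  linear_combination r4 / 5

theorem coeff_two_logBlock_mul (h t c : L) (ht : t ≠ 0) (hdet2 : (wordGram c t words2).det ≠ 0)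
    (hdet3 : (wordGram c t words3).det ≠ 0) (hdet4 : (wordGram c t words4).det ≠ 0)
    (hdet5 : (wordGram c t words5).det ≠ 0) (h2 : kac2 t c ≠ 0) :
    PowerSeries.coeff 2 (logBlock h t c) * (8 * kac2 t c) = logPoly2 h t c := by
  rw [(coeff_logBlock h t c ht hdet2 hdet3 hdet4 hdet5).2.1]
  linear_combination (norm := skip) 8 * blockCoeff_two h t c hdet2 h2
  rw [kac2, logPoly2]
  ring

set_option maxHeartbeats 4000000 in
theorem coeff_four_logBlock_mul (h t c : L) (ht : t ≠ 0) (hdet2 : (wordGram c t words2).det ≠ 0)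
    (hdet3 : (wordGram c t words3).det ≠ 0) (hdet4 : (wordGram c t words4).det ≠ 0)
    (hdet5 : (wordGram c t words5).det ≠ 0) (h2 : kac2 t c ≠ 0) (h4 : kac4 t c ≠ 0) :
    PowerSeries.coeff 4 (logBlock h t c) * (32 * (kac2 t c ^ 2 * kac4 t c)) = logPoly4 h t c := by
  rw [(coeff_logBlock h t c ht hdet2 hdet3 hdet4 hdet5).2.2.2.1]
  have e2 := blockCoeff_two h t c hdet2 h2
  have e4 := blockCoeff_four h t c hdet4 h2 h4
  set F2 := blockCoeff h t c 2
  set F4 := blockCoeff h t c 4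
  -- Regrouped so that the block coefficients occur only multiplied by their own denominators.
  have key : (F4 - t / 2 * ((t + 2) / 2 * F2 - t * (t + 1) * (t + 2) / 24) - F2 ^ 2 / 2
      + t ^ 2 / 4 * F2 - t ^ 4 / 64) * (32 * (kac2 t c ^ 2 * kac4 t c)) =
        32 * ((F4 * (kac2 t c * kac4 t c)) * kac2 t c
        - t / 2 * ((t + 2) / 2 * (F2 * kac2 t c)
          - t * (t + 1) * (t + 2) / 24 * kac2 t c) * kac2 t c * kac4 t c
        - (F2 * kac2 t c) ^ 2 / 2 * kac4 t c
        + t ^ 2 / 4 * (F2 * kac2 t c) * kac2 t c * kac4 t c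
        - t ^ 4 / 64 * kac2 t c ^ 2 * kac4 t c) := by ring
  rw [key, e2, e4, kac2, kac4, logPoly4]
  ring

/-- Parametrisation of `c`, `t`, `h` by a scale `s`, with `v = 1 / t`. -/
theorem kac2_scaled (s a b v : L) (hv : s * b * v = 1) :
    kac2 (s * b) (s * a) = s * b * s * scaledKac2 a b v := by
  rw [kac2, scaledKac2]
  linear_combination (10 * s * b - s * a) * hv

theorem kac4_scaled (s a b v : L) (hv : s * b * v = 1) :
    kac4 (s * b) (s * a) = s * b * s ^ 2 * scaledKac4 a b v := by
  have hs : s ≠ 0 := by rintro rfl; simp at hv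
  have hb : b ≠ 0 := by rintro rfl; simp at hv
  obtain rfl : v = 1 / (s * b) := by rw [eq_div_iff (mul_ne_zero hs hb)]; linear_combination hv
  rw [kac4, scaledKac4]
  field_simp

/-- This is exponentiation at level two: after division by the Kac factor `s * b * s * scaledKac2 a
b v` a single factor `t = s * b` remains. Lower-degree monomials are absorbed through `v = 1 / t`
and `b v = 1 / s`. -/
theorem logNum2_scaled (s a b κ v : L) (hv : s * b * v = 1) :
    logPoly2 (κ * (s * b)) (s * b) (s * a) = (s * b) ^ 2 * s * logNum2 a b κ v := by
  have hs : s ≠ 0 := by rintro rfl; simp at hv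
  have hb : b ≠ 0 := by rintro rfl; simp at hv
  obtain rfl : v = 1 / (s * b) := by rw [eq_div_iff (mul_ne_zero hs hb)]; linear_combination hv
  simp only [logPoly2, logNum2]
  field_simp

set_option maxHeartbeats 4000000 in
theorem logNum4_scaled (s a b κ v : L) (hv : s * b * v = 1) :
    logPoly4 (κ * (s * b)) (s * b) (s * a) = (s * b) ^ 4 * s ^ 4 * logNum4 a b κ v := by
  have hs : s ≠ 0 := by rintro rfl; simp at hv
  have hb : b ≠ 0 := by rintro rfl; simp at hv
  obtain rfl : v = 1 / (s * b) := by rw [eq_div_iff (mul_ne_zero hs hb)]; linear_combination hv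
  simp only [logPoly4, logNum4]
  field_simp

end LogCoefficients

/-! ### Expansions with coefficients independent of `α`. -/

section Uniform

open HahnSeries

variable {K : Type*} [Field K]

theorem map_logNum2 {R S : Type*} [CommRing R] [CommRing S] (φ : R →+* S) (a b κ v : R) :
    φ (logNum2 a b κ v) = logNum2 (φ a) (φ b) (φ κ) (φ v) := by
  simp only [logNum2, map_add, map_sub, map_mul, map_pow, map_ofNat]

set_option maxHeartbeats 4000000 in
theorem map_logNum4 {R S : Type*} [CommRing R] [CommRing S] (φ : R →+* S) (a b κ v : R) :
    φ (logNum4 a b κ v) = logNum4 (φ a) (φ b) (φ κ) (φ v) := by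
  simp only [logNum4, map_add, map_sub, map_mul, map_pow, map_ofNat]

/-- A set of exponents `α` with families `u`, `v` of expansion parameters of positive order, `v`
being of order at least `α`. -/
structure IsRegime (A : Set ℚ) (u v : ℚ → HahnSeries ℚ K) : Prop where
  pos : ∀ α ∈ A, 0 < α
  u_pos : ∀ α ∈ A, 0 < (u α).orderTop
  le_v : ∀ α ∈ A, (α : WithTop ℚ) ≤ addVal ℚ K (v α)

/-- The family `x` has an expansion as in `FirstOrder` with coefficients independent of `α`, and
`k` is the leading one. -/
def UniformFirstOrder (A : Set ℚ) (u v x : ℚ → HahnSeries ℚ K) (k : K) : Prop :=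
  ∃ (f : K⟦X⟧) (b : K), PowerSeries.constantCoeff f = k ∧
    ∀ α ∈ A, FirstOrder α (u α) (v α) (x α) f b

variable {A : Set ℚ} {u v x y : ℚ → HahnSeries ℚ K} {k l : K}

theorem UniformFirstOrder.add (hx : UniformFirstOrder A u v x k)
    (hy : UniformFirstOrder A u v y l) : UniformFirstOrder A u v (x + y) (k + l) := by
  obtain ⟨f, b, rfl, hf⟩ := hx
  obtain ⟨g, b', rfl, hg⟩ := hy
  exact ⟨f + g, b + b', map_add _ _ _, fun α hα => (hf α hα).add (hg α hα)⟩

theorem UniformFirstOrder.mul (hR : IsRegime A u v) (hx : UniformFirstOrder A u v x k)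
    (hy : UniformFirstOrder A u v y l) : UniformFirstOrder A u v (x * y) (k * l) := by
  obtain ⟨f, b, rfl, hf⟩ := hx
  obtain ⟨g, b', rfl, hg⟩ := hy
  exact ⟨f * g, _, map_mul _ _ _, fun α hα =>
    (hf α hα).mul (hR.pos α hα) (hR.u_pos α hα) (hR.le_v α hα) (hg α hα)⟩

theorem uniformFirstOrder_C (k : K) :
    UniformFirstOrder A u v (fun _ => HahnSeries.C k) k :=
  ⟨PowerSeries.C k, 0, by simp, fun α _ => firstOrder_C k⟩

theorem uniformFirstOrder_ofNat (n : ℕ) [n.AtLeastTwo] :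
    UniformFirstOrder A u v (ofNat(n)) (ofNat(n)) := by
  have := uniformFirstOrder_C (A := A) (u := u) (v := v) (K := K) (ofNat(n))
  rwa [map_ofNat] at this

theorem uniformFirstOrder_one : UniformFirstOrder A u v 1 1 := by
  have := uniformFirstOrder_C (A := A) (u := u) (v := v) (K := K) 1
  rwa [map_one] at this

theorem UniformFirstOrder.neg (hR : IsRegime A u v) (hx : UniformFirstOrder A u v x k) :
    UniformFirstOrder A u v (-x) (-k) := by
  have := (uniformFirstOrder_C (A := A) (u := u) (v := v) (-1 : K)).mul hR hx
  convert this using 1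
  · ext1 α
    simp
  · ring

theorem UniformFirstOrder.sub (hR : IsRegime A u v) (hx : UniformFirstOrder A u v x k)
    (hy : UniformFirstOrder A u v y l) : UniformFirstOrder A u v (x - y) (k - l) := by
  rw [sub_eq_add_neg, sub_eq_add_neg]
  exact hx.add (hy.neg hR)

theorem UniformFirstOrder.inv (hR : IsRegime A u v) (hx : UniformFirstOrder A u v x k)
    (hk : k ≠ 0) : UniformFirstOrder A u v (x⁻¹) k⁻¹ := by
  obtain ⟨f, b, rfl, hf⟩ := hx
  exact ⟨f⁻¹, _, PowerSeries.constantCoeff_inv f, fun α hα =>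
    (hf α hα).inv (hR.pos α hα) (hR.u_pos α hα) (hR.le_v α hα) hk⟩

/-- If `x α` vanished, so would `x α * (x α)⁻¹`, whose expansion has constant term 1 while all its
other terms have positive order. -/
theorem UniformFirstOrder.ne_zero (hR : IsRegime A u v) (hx : UniformFirstOrder A u v x k)
    (hk : k ≠ 0) {α : ℚ} (hα : α ∈ A) : x α ≠ 0 := by
  intro h0
  have h := hx.mul hR (hx.inv hR hk)
  rw [mul_inv_cancel₀ hk] at h
  obtain ⟨f, b, hf, hfb⟩ := h
  have := hfb α hα
  rw [FirstOrder, Pi.mul_apply, h0, zero_mul, zero_sub, AddValuation.map_neg] at this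
  have h1 := zero_lt_addVal_heval_sub (u α) (hR.u_pos α hα) f
  have hα' : (0 : WithTop ℚ) < α := by exact_mod_cast hR.pos α hα
  have h2 : 0 < addVal ℚ K (HahnSeries.C b * v α) := by
    rw [AddValuation.map_mul]
    exact lt_of_lt_of_le hα' (le_add_of_nonneg_of_le (zero_le_addVal_C b) (hR.le_v α hα))
  have h3 := AddValuation.map_lt_add _ (AddValuation.map_lt_add _ h1 h2)
    (by rw [AddValuation.map_neg]; exact hα'.trans this)
  have h4 : PowerSeries.heval (u α) f - HahnSeries.C (PowerSeries.constantCoeff f) +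
      HahnSeries.C b * v α + -(PowerSeries.heval (u α) f + HahnSeries.C b * v α) = -1 := by
    rw [hf, map_one]
    ring
  rw [h4, AddValuation.map_neg, AddValuation.map_one] at h3
  exact lt_irrefl _ h3

theorem IsRegime.uniformFirstOrder_u (hR : IsRegime A u v) : UniformFirstOrder A u v u 0 :=
  ⟨PowerSeries.X, 0, by simp, fun α hα => firstOrder_u (hR.u_pos α hα)⟩

theorem uniformFirstOrder_v : UniformFirstOrder A u v v 0 :=
  ⟨0, 1, by simp, fun α hα => firstOrder_v⟩

/-- The families with a uniform first-order expansion form a ring. -/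
def IsRegime.subring (hR : IsRegime A u v) : Subring (ℚ → HahnSeries ℚ K) where
  carrier := {x | ∃ k, UniformFirstOrder A u v x k}
  mul_mem' := fun ⟨k, hx⟩ ⟨l, hy⟩ => ⟨k * l, hx.mul hR hy⟩
  one_mem' := ⟨1, uniformFirstOrder_one⟩
  add_mem' := fun ⟨k, hx⟩ ⟨l, hy⟩ => ⟨k + l, hx.add hy⟩
  zero_mem' := ⟨0, by
    have := uniformFirstOrder_C (A := A) (u := u) (v := v) (0 : K)
    rwa [map_zero] at this⟩
  neg_mem' := fun ⟨k, hx⟩ => ⟨-k, hx.neg hR⟩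

variable [CharZero K]

theorem scaledKac2_uniform (hR : IsRegime A u v) {a b : ℚ → HahnSeries ℚ K} {a0 b0 : K}
    (ha : UniformFirstOrder A u v a a0) (hb : UniformFirstOrder A u v b b0) :
    UniformFirstOrder A u v (scaledKac2 a b v) (16 * b0 + 2 * a0) := by
  have := ((((uniformFirstOrder_ofNat 16).mul hR hb).add ((uniformFirstOrder_ofNat 2).mul hR ha)).sub
    hR (((uniformFirstOrder_ofNat 10).mul hR hb).mul hR uniformFirstOrder_v)).add
      (ha.mul hR uniformFirstOrder_v)
  rw [scaledKac2]
  convert this using 1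
  ring

theorem scaledKac4_uniform (hR : IsRegime A u v) {a b : ℚ → HahnSeries ℚ K} {a0 b0 : K}
    (ha : UniformFirstOrder A u v a a0) (hb : UniformFirstOrder A u v b b0) :
    UniformFirstOrder A u v (scaledKac4 a b v) ((a0 + 8 * b0) * (20 * a0 + 32 * b0)) := by
  have hv := uniformFirstOrder_v (A := A) (u := u) (v := v)
  have h1 := (ha.add ((uniformFirstOrder_ofNat 8).mul hR hb)).sub hR (hb.mul hR hv)
  have h2 := (((((uniformFirstOrder_ofNat 20).mul hR ha).add
    (((uniformFirstOrder_ofNat 30).mul hR ha).mul hR hv)).add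
    ((uniformFirstOrder_ofNat 32).mul hR hb)).sub hR
    (((uniformFirstOrder_ofNat 164).mul hR hb).mul hR hv)).add
    (((uniformFirstOrder_ofNat 132).mul hR hb).mul hR (hv.mul hR hv))
  have := h1.mul hR h2
  rw [scaledKac4]
  convert this using 1
  · rw [pow_two]
  · ring

theorem coeff_two_logBlock_scaled {L : Type*} [Field L] [CharZero L] [Algebra ℚ L]
    (s a b κ w h t c : L) (hw : s * b * w = 1) (hc : c = s * a) (ht : t = s * b) (hh : h = κ * t)
    (hdet2 : (wordGram c t words2).det ≠ 0)
    (hdet3 : (wordGram c t words3).det ≠ 0) (hdet4 : (wordGram c t words4).det ≠ 0)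
    (hdet5 : (wordGram c t words5).det ≠ 0) (h2 : scaledKac2 a b w ≠ 0) :
    PowerSeries.coeff 2 (logBlock h t c) = t * (logNum2 a b κ w * (8 * scaledKac2 a b w)⁻¹) := by
  subst hh hc ht
  have hs : s ≠ 0 := by rintro rfl; simp at hw
  have hb : b ≠ 0 := by rintro rfl; simp at hw
  have hk : kac2 (s * b) (s * a) ≠ 0 := by
    rw [kac2_scaled s a b w hw]
    exact mul_ne_zero (mul_ne_zero (mul_ne_zero hs hb) hs) h2
  have := coeff_two_logBlock_mul (κ * (s * b)) (s * b) (s * a) (mul_ne_zero hs hb) hdet2 hdet3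
    hdet4 hdet5 hk
  rw [kac2_scaled s a b w hw, logNum2_scaled s a b κ w hw] at this
  rw [← div_eq_mul_inv, ← mul_div_assoc, eq_div_iff (mul_ne_zero (by norm_num) h2)]
  refine mul_left_cancel₀ (mul_ne_zero (mul_ne_zero hs hb) hs) ?_
  linear_combination this

theorem coeff_four_logBlock_scaled {L : Type*} [Field L] [CharZero L] [Algebra ℚ L]
    (s a b κ w h t c : L) (hw : s * b * w = 1) (hc : c = s * a) (ht : t = s * b) (hh : h = κ * t)
    (hdet2 : (wordGram c t words2).det ≠ 0)
    (hdet3 : (wordGram c t words3).det ≠ 0) (hdet4 : (wordGram c t words4).det ≠ 0)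
    (hdet5 : (wordGram c t words5).det ≠ 0) (h2 : scaledKac2 a b w ≠ 0)
    (h4 : scaledKac4 a b w ≠ 0) :
    PowerSeries.coeff 4 (logBlock h t c) =
      t * (logNum4 a b κ w * (32 * (scaledKac2 a b w * scaledKac2 a b w * scaledKac4 a b w))⁻¹) := by
  subst hh hc ht
  have hs : s ≠ 0 := by rintro rfl; simp at hw
  have hb : b ≠ 0 := by rintro rfl; simp at hw
  have hk2 : kac2 (s * b) (s * a) ≠ 0 := by
    rw [kac2_scaled s a b w hw]
    exact mul_ne_zero (mul_ne_zero (mul_ne_zero hs hb) hs) h2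
  have hk4 : kac4 (s * b) (s * a) ≠ 0 := by
    rw [kac4_scaled s a b w hw]
    exact mul_ne_zero (mul_ne_zero (mul_ne_zero hs hb) (pow_ne_zero 2 hs)) h4
  have := coeff_four_logBlock_mul (κ * (s * b)) (s * b) (s * a) (mul_ne_zero hs hb) hdet2 hdet3
    hdet4 hdet5 hk2 hk4
  rw [kac2_scaled s a b w hw, kac4_scaled s a b w hw, logNum4_scaled s a b κ w hw] at this
  rw [← div_eq_mul_inv, ← mul_div_assoc,
    eq_div_iff (mul_ne_zero (by norm_num) (mul_ne_zero (mul_ne_zero h2 h2) h4))]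
  refine mul_left_cancel₀ (mul_ne_zero (pow_ne_zero 3 (mul_ne_zero hs hb)) (pow_ne_zero 4 hs)) ?_
  generalize PowerSeries.coeff 4 (logBlock (κ * (s * b)) (s * b) (s * a)) = g at *
  linear_combination this

theorem heavyLogBlock_eq [inst : Algebra ℚ (HahnSeries ℚ K)] (δ δt : K) (α : ℚ) :
    heavyLogBlock δ δt α = logBlock (cMonomial δ α) (cMonomial δt α) (cMonomial 1 1) := by
  rw [heavyLogBlock, Subsingleton.elim inst]

/-- The conditions `h2` and `h4` make the Kac factors invertible to leading order. The scale `s`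
(`c` below `α = 1`, `t` above) lets one argument serve both regimes. -/
theorem exists_firstOrder_logBlock (hR : IsRegime A u v) (δ δt : K) (hδt : δt ≠ 0)
    {s a b : ℚ → HahnSeries ℚ K} {a0 b0 : K} (ha : UniformFirstOrder A u v a a0)
    (hb : UniformFirstOrder A u v b b0) (h2 : 16 * b0 + 2 * a0 ≠ 0)
    (h4 : (a0 + 8 * b0) * (20 * a0 + 32 * b0) ≠ 0)
    (hc : ∀ α ∈ A, cMonomial (1 : K) 1 = s α * a α) (ht : ∀ α ∈ A, cMonomial δt α = s α * b α)
    (hv : ∀ α ∈ A, cMonomial δt α * v α = 1)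
    (hdet2 : ∀ α ∈ A, (wordGram (cMonomial (1 : K) 1) (cMonomial δt α) words2).det ≠ 0)
    (hdet3 : ∀ α ∈ A, (wordGram (cMonomial (1 : K) 1) (cMonomial δt α) words3).det ≠ 0)
    (hdet4 : ∀ α ∈ A, (wordGram (cMonomial (1 : K) 1) (cMonomial δt α) words4).det ≠ 0)
    (hdet5 : ∀ α ∈ A, (wordGram (cMonomial (1 : K) 1) (cMonomial δt α) words5).det ≠ 0)
    (n : ℕ) (hn : n < 6) :
    ∃ (f : K⟦X⟧) (b : K), ∀ α ∈ A, ∃ x, FirstOrder α (u α) (v α) x f b ∧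
      PowerSeries.coeff n (heavyLogBlock δ δt α) = cMonomial δt α * x := by
  haveI : CharZero (HahnSeries ℚ K) := charZero_of_injective_ringHom HahnSeries.C_injective
  set κ : ℚ → HahnSeries ℚ K := fun _ => HahnSeries.C (δ / δt) with hκ
  have hκ' : UniformFirstOrder A u v κ _ := uniformFirstOrder_C (δ / δt)
  have hh : ∀ α, cMonomial δ α = κ α * cMonomial δt α := fun α => by
    simp only [hκ, cMonomial, HahnSeries.C_apply, HahnSeries.single_mul_single, zero_add]
    rw [div_mul_cancel₀ _ hδt]
  have ht0 : ∀ α, cMonomial δt α ≠ 0 := fun α => by simpa [cMonomial] using hδt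
  have hk2 := scaledKac2_uniform hR ha hb
  have hk4 := scaledKac4_uniform hR ha hb
  -- Evaluating the polynomial inside the subring of uniform families gives its expansion without
  -- treating the monomials one by one; the leading coefficient is irrelevant.
  obtain ⟨k2, hn2⟩ : ∃ k, UniformFirstOrder A u v (logNum2 a b κ v) k := by
    have h := map_logNum2 hR.subring.subtype ⟨a, _, ha⟩ ⟨b, _, hb⟩ ⟨κ, _, hκ'⟩
      ⟨v, _, uniformFirstOrder_v⟩
    have h' := (logNum2 (⟨a, _, ha⟩ : hR.subring) ⟨b, _, hb⟩ ⟨κ, _, hκ'⟩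
      ⟨v, _, uniformFirstOrder_v⟩).2
    rw [Subring.subtype_apply] at h
    rw [h] at h'
    exact h'
  obtain ⟨k4, hn4⟩ : ∃ k, UniformFirstOrder A u v (logNum4 a b κ v) k := by
    have h := map_logNum4 hR.subring.subtype ⟨a, _, ha⟩ ⟨b, _, hb⟩ ⟨κ, _, hκ'⟩
      ⟨v, _, uniformFirstOrder_v⟩
    have h' := (logNum4 (⟨a, _, ha⟩ : hR.subring) ⟨b, _, hb⟩ ⟨κ, _, hκ'⟩
      ⟨v, _, uniformFirstOrder_v⟩).2
    rw [Subring.subtype_apply] at h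
    rw [h] at h'
    exact h'
  have hx2 := hn2.mul hR (((uniformFirstOrder_ofNat 8).mul hR hk2).inv hR
    (mul_ne_zero (by norm_num) h2))
  have hx4 := hn4.mul hR (((uniformFirstOrder_ofNat 32).mul hR ((hk2.mul hR hk2).mul hR hk4)).inv hR
    (mul_ne_zero (by norm_num) (mul_ne_zero (mul_ne_zero h2 h2) h4)))
  have e2 : ∀ α ∈ A, PowerSeries.coeff 2 (heavyLogBlock δ δt α) = cMonomial δt α *
      (logNum2 a b κ v * (8 * scaledKac2 a b v)⁻¹) α := fun α hα => by
    have := coeff_two_logBlock_scaled (s α) (a α) (b α) (κ α) (v α) _ _ _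
      (by rw [← ht α hα]; exact hv α hα) (hc α hα) (ht α hα) (hh α) (hdet2 α hα) (hdet3 α hα)
      (hdet4 α hα) (hdet5 α hα) (hk2.ne_zero hR h2 hα)
    rw [heavyLogBlock_eq, this, Pi.mul_apply]
    have h := map_logNum2 (Pi.evalRingHom (fun _ : ℚ => HahnSeries ℚ K) α) a b κ v
    simp only [Pi.evalRingHom_apply] at h
    rw [← h]
    rfl
  have e4 : ∀ α ∈ A, PowerSeries.coeff 4 (heavyLogBlock δ δt α) = cMonomial δt α *
      (logNum4 a b κ v * (32 * (scaledKac2 a b v * scaledKac2 a b v * scaledKac4 a b v))⁻¹) α :=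
    fun α hα => by
      have := coeff_four_logBlock_scaled (s α) (a α) (b α) (κ α) (v α) _ _ _
        (by rw [← ht α hα]; exact hv α hα) (hc α hα) (ht α hα) (hh α) (hdet2 α hα) (hdet3 α hα)
        (hdet4 α hα) (hdet5 α hα) (hk2.ne_zero hR h2 hα) (hk4.ne_zero hR h4 hα)
      rw [heavyLogBlock_eq, this, Pi.mul_apply]
      have h := map_logNum4 (Pi.evalRingHom (fun _ : ℚ => HahnSeries ℚ K) α) a b κ v
      simp only [Pi.evalRingHom_apply] at h
      rw [← h]
      rfl
  have hall := fun α hα => coeff_logBlock (cMonomial δ α) (cMonomial δt α) (cMonomial (1 : K) 1)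
    (ht0 α) (hdet2 α hα) (hdet3 α hα) (hdet4 α hα) (hdet5 α hα)
  have finish : ∀ {x : ℚ → HahnSeries ℚ K} {k : K} {n : ℕ}, UniformFirstOrder A u v x k →
      (∀ α ∈ A, PowerSeries.coeff n (heavyLogBlock δ δt α) = cMonomial δt α * x α) →
      ∃ (f : K⟦X⟧) (b : K), ∀ α ∈ A, ∃ x, FirstOrder α (u α) (v α) x f b ∧
        PowerSeries.coeff n (heavyLogBlock δ δt α) = cMonomial δt α * x := by
    rintro x k n ⟨f, b, -, hf⟩ hx
    exact ⟨f, b, fun α hα => ⟨x α, hf α hα, hx α hα⟩⟩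
  have hC : ∀ q : K, UniformFirstOrder A u v (fun _ => HahnSeries.C q) q := uniformFirstOrder_C
  interval_cases n
  · exact finish (hC 0) fun α hα => by
      rw [heavyLogBlock_eq, coeff_logBlock_zero, map_zero, mul_zero]
  · exact finish (hC (1 / 2)) fun α hα => by
      rw [heavyLogBlock_eq, (hall α hα).1, map_div₀, map_one, map_ofNat]
      ring
  · exact finish hx2 e2
  · exact finish (hx2.sub hR (hC (1 / 12))) fun α hα => by
      have := e2 α hα
      rw [heavyLogBlock_eq] at this ⊢
      rw [(hall α hα).2.2.1, this, Pi.sub_apply, map_div₀, map_one, map_ofNat]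
      ring
  · exact finish hx4 e4
  · exact finish ((((hC 2).mul hR hx4).sub hR hx2).add (hC (1 / 10))) fun α hα => by
      have h2 := e2 α hα
      have h4 := e4 α hα
      rw [heavyLogBlock_eq] at h2 h4 ⊢
      rw [(hall α hα).2.2.2.2, h2, h4]
      change _ = _ * ((HahnSeries.C 2 : HahnSeries ℚ K) * _ - _ +
        (HahnSeries.C (1 / 10) : HahnSeries ℚ K))
      rw [map_div₀, map_one, map_ofNat, map_ofNat]
      ring

end Uniform

/-! ### Reading off the coefficients of non-negative powers of `c`. -/

section Extraction

open HahnSeries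

variable {K : Type*} [Field K]

theorem coeff_heval_single {θ : ℚ} (hθ : 0 < θ) (u₀ : K) (f : K⟦X⟧) (i : ℕ) :
    (PowerSeries.heval (single θ u₀) f).coeff (i * θ) = PowerSeries.coeff i f * u₀ ^ i := by
  have hu : 0 < (single θ u₀).orderTop := lt_orderTop_single hθ
  rw [PowerSeries.coeff_heval, finsum_eq_single _ i]
  · simp [SummableFamily.powers_of_orderTop_pos hu, single_pow]
  · intro j hj
    have : (i : ℚ) * θ ≠ j * θ := fun h =>
      hj (by exact_mod_cast (mul_right_cancel₀ hθ.ne' h).symm)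
    simp [SummableFamily.powers_of_orderTop_pos hu, single_pow, coeff_single_of_ne this]

theorem coeff_heval_single_of_ne {θ : ℚ} (hθ : 0 < θ) (u₀ : K) (f : K⟦X⟧) {e : ℚ}
    (he : ∀ i : ℕ, e ≠ i * θ) : (PowerSeries.heval (single θ u₀) f).coeff e = 0 := by
  have hu : 0 < (single θ u₀).orderTop := lt_orderTop_single hθ
  rw [PowerSeries.coeff_heval]
  refine finsum_eq_zero_of_forall_eq_zero fun j => ?_
  simp [SummableFamily.powers_of_orderTop_pos hu, single_pow, coeff_single_of_ne (he j)]

theorem FirstOrder.coeff_eq {α : ℚ} {u x : HahnSeries ℚ K} {v₀ b : K} {f : K⟦X⟧}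
    (hx : FirstOrder α u (single α v₀) x f b) {e : ℚ} (he : e ≤ α) :
    x.coeff e = (PowerSeries.heval u f).coeff e + if e = α then b * v₀ else 0 := by
  have h0 := coeff_eq_zero_of_lt_orderTop (x := x - (PowerSeries.heval u f +
    HahnSeries.C b * single α v₀)) (i := e) (by
      rw [← addVal_apply]
      exact lt_of_le_of_lt (WithTop.coe_le_coe.mpr he) hx)
  rw [coeff_sub, sub_eq_zero] at h0
  rw [h0, coeff_add, HahnSeries.C_apply, single_mul_single, zero_add]
  by_cases h : e = α
  · simp [h]
  · simp [h, coeff_single_of_ne h]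

/-- Coefficients of the logarithmic block that are uniform in the exponent `α`. -/
theorem exists_uniform_coefficients [CharZero K] {A : Set ℚ} {θ : ℚ → ℚ} {u₀ v₀ : K} (δ δt : K)
    (hθ : ∀ α ∈ A, 0 < θ α)
    (h : ∀ n < 6, ∃ (f : K⟦X⟧) (b : K), ∀ α ∈ A, ∃ x,
      FirstOrder α (single (θ α) u₀) (single α v₀) x f b ∧
        PowerSeries.coeff n (heavyLogBlock δ δt α) = cMonomial δt α * x) :
    ∃ (p : ℕ → K[X]) (q : K[X]), ∀ α ∈ A, ∀ a : ℚ, 0 ≤ a →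
      (∀ i : ℕ, a = α - i * θ α → puiseuxCoeff δ δt α a = p i + if a = 0 then q else 0) ∧
      ((∀ i : ℕ, a ≠ α - i * θ α) → puiseuxCoeff δ δt α a = if a = 0 then q else 0) := by
  choose! f b hfb using h
  refine ⟨fun i => PowerSeries.trunc 6 (PowerSeries.mk fun n =>
    δt * (PowerSeries.coeff i (f n) * u₀ ^ i)),
    PowerSeries.trunc 6 (PowerSeries.mk fun n => δt * (b n * v₀)), fun α hα a ha => ?_⟩
  have key : ∀ n < 6, (PowerSeries.coeff n (heavyLogBlock δ δt α)).coeff (-a) =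
      δt * ((PowerSeries.heval (single (θ α) u₀) (f n)).coeff (α - a) +
        if a = 0 then b n * v₀ else 0) := by
    intro n hn
    obtain ⟨x, hx, hxe⟩ := hfb n hn α hα
    -- The factor `t` has order `-α`, so for `a ≥ 0` only coefficients of `x` of order `α - a ≤ α`
    -- enter, exactly the known range. The term in `v` contributes at `a = 0` alone.
    rw [hxe, cMonomial, coeff_single_mul, sub_neg_eq_add, neg_add_eq_sub,
      hx.coeff_eq (sub_le_self α ha)]
    simp only [sub_eq_self]
  constructor
  · intro i hi
    ext n
    have hai : α - a = i * θ α := by rw [hi]; ring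
    by_cases hn : n < 6
    · have k := key n hn
      rw [hai, coeff_heval_single (hθ α hα)] at k
      by_cases h0 : a = 0
      · rw [if_pos h0] at k ⊢
        simp only [puiseuxCoeff, Polynomial.coeff_add, PowerSeries.coeff_trunc, hn, if_true,
          PowerSeries.coeff_mk, k]
        ring
      · rw [if_neg h0, add_zero] at k ⊢
        simp only [puiseuxCoeff, PowerSeries.coeff_trunc, hn, if_true, PowerSeries.coeff_mk, k]
    · split_ifs <;> simp [puiseuxCoeff, PowerSeries.coeff_trunc, hn]
  · intro hi
    ext n
    by_cases hn : n < 6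
    · have k := key n hn
      rw [coeff_heval_single_of_ne (hθ α hα) u₀ (f n) fun i h => hi i (by rw [← h]; ring),
        zero_add] at k
      by_cases h0 : a = 0
      · rw [if_pos h0] at k ⊢
        simp only [puiseuxCoeff, PowerSeries.coeff_trunc, hn, if_true, PowerSeries.coeff_mk, k]
      · rw [if_neg h0, mul_zero] at k
        simp only [puiseuxCoeff, PowerSeries.coeff_trunc, hn, if_true, PowerSeries.coeff_mk, k, h0,
          if_false, Polynomial.coeff_zero]
    · split_ifs <;> simp [puiseuxCoeff, PowerSeries.coeff_trunc, hn]

theorem addVal_ratCast [CharZero K] (q : ℚ) (hq : q ≠ 0) :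
    addVal ℚ K (q : HahnSeries ℚ K) = (0 : ℚ) := by
  rw [← map_ratCast (HahnSeries.C : K →+* HahnSeries ℚ K) q, addVal_apply, HahnSeries.C_apply,
    orderTop_single (by exact_mod_cast hq)]

theorem addVal_cMonomial {x : K} (hx : x ≠ 0) (a : ℚ) :
    addVal ℚ K (cMonomial x a) = ((-a : ℚ) : WithTop ℚ) := by
  rw [cMonomial, addVal_apply, orderTop_single hx]

variable [CharZero K]

theorem det_wordGram_cMonomial {δt : K} (hδt : δt ≠ 0) {α : ℚ} (h0 : 0 < α) (h1 : α ≠ 1) :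
    (wordGram (cMonomial (1 : K) 1) (cMonomial δt α) words2).det ≠ 0 ∧
    (wordGram (cMonomial (1 : K) 1) (cMonomial δt α) words3).det ≠ 0 ∧
    (wordGram (cMonomial (1 : K) 1) (cMonomial δt α) words4).det ≠ 0 ∧
    (wordGram (cMonomial (1 : K) 1) (cMonomial δt α) words5).det ≠ 0 := by
  haveI : CharZero (HahnSeries ℚ K) := charZero_of_injective_ringHom HahnSeries.C_injective
  have hnum : ∀ q : ℚ, q ≠ 0 → addVal ℚ K (q : HahnSeries ℚ K) = (0 : ℚ) := addVal_ratCast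
  have hc := addVal_cMonomial (one_ne_zero (α := K)) 1
  have ht := addVal_cMonomial hδt α
  have hneg : -α < 0 := by linarith
  generalize hC : cMonomial (1 : K) 1 = C at *
  generalize hT : cMonomial δt α = T at *
  rcases lt_or_gt_of_ne h1 with h | h
  · have hlt : (-1 : ℚ) < -α := by linarith
    refine ⟨?_, ?_, ?_, ?_⟩
    · exact det_wordGram_words2_of_lt hnum hc ht hlt hneg
    · exact det_wordGram_words3_of_lt hnum hc ht hlt hneg
    · exact det_wordGram_words4_of_lt hnum hc ht hlt hneg
    · exact det_wordGram_words5_of_lt hnum hc ht hlt hneg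
  · have hlt : -α < (-1 : ℚ) := by linarith
    have h2 : (-1 : ℚ) < 0 := by norm_num
    refine ⟨?_, ?_, ?_, ?_⟩
    · exact det_wordGram_words2_of_gt hnum hc ht hlt h2
    · exact det_wordGram_words3_of_gt hnum hc ht hlt h2
    · exact det_wordGram_words4_of_gt hnum hc ht hlt h2
    · exact det_wordGram_words5_of_gt hnum hc ht hlt h2

theorem isUnit_det_gramMatrix {F : Type*} [Field F] [CharZero F] {c t : F} (ht : t ≠ 0)
    (d2 : (wordGram c t words2).det ≠ 0) (d3 : (wordGram c t words3).det ≠ 0)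
    (d4 : (wordGram c t words4).det ≠ 0) (d5 : (wordGram c t words5).det ≠ 0) {n : ℕ}
    (hn : n ≤ 5) : IsUnit (gramMatrix c t n).det := by
  rw [isUnit_iff_ne_zero]
  interval_cases n
  · rw [isPartitionEnum_words0.det_gramMatrix, wordGram_words0]
    simp
  · rw [isPartitionEnum_words1.det_gramMatrix, wordGram_words1]
    simpa using ht
  · rwa [isPartitionEnum_words2.det_gramMatrix]
  · rwa [isPartitionEnum_words3.det_gramMatrix]
  · rwa [isPartitionEnum_words4.det_gramMatrix]
  · rwa [isPartitionEnum_words5.det_gramMatrix]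

theorem isUnit_det_gramMatrix_cMonomial {δt : K} (hδt : δt ≠ 0) {α : ℚ} (h0 : 0 < α) (h1 : α ≠ 1)
    {n : ℕ} (hn : n ≤ 5) :
    IsUnit (gramMatrix (cMonomial (1 : K) 1) (cMonomial δt α) n).det := by
  haveI : CharZero (HahnSeries ℚ K) := charZero_of_injective_ringHom HahnSeries.C_injective
  obtain ⟨d2, d3, d4, d5⟩ := det_wordGram_cMonomial hδt h0 h1
  have ht : cMonomial δt α ≠ 0 := by simpa [cMonomial] using hδt
  exact isUnit_det_gramMatrix ht d2 d3 d4 d5 hn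

/-- The scale is `s = c`, with `a = 1` and `b = u = t / c`. -/
theorem exists_coefficients_of_lt_one (δ δt : K) (hδt : δt ≠ 0) :
    ∃ (p : ℕ → K[X]) (q : K[X]), ∀ α ∈ Set.Ioo (0 : ℚ) 1, ∀ a : ℚ, 0 ≤ a →
      (∀ i : ℕ, a = α - i * (1 - α) → puiseuxCoeff δ δt α a = p i + if a = 0 then q else 0) ∧
      ((∀ i : ℕ, a ≠ α - i * (1 - α)) → puiseuxCoeff δ δt α a = if a = 0 then q else 0) := by
  have hR : IsRegime (K := K) (Set.Ioo (0 : ℚ) 1) (fun α => single (1 - α) δt)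
      (fun α => single α δt⁻¹) :=
    ⟨fun α hα => hα.1, fun α hα => lt_orderTop_single (sub_pos.mpr hα.2),
      fun α _ => by rw [addVal_apply]; exact orderTop_single_le⟩
  have hdet := fun α (hα : α ∈ Set.Ioo (0 : ℚ) 1) => det_wordGram_cMonomial hδt hα.1 hα.2.ne
  refine exists_uniform_coefficients δ δt (fun α hα => sub_pos.mpr hα.2)
    (exists_firstOrder_logBlock hR δ δt hδt (s := fun _ => cMonomial (1 : K) 1)
      uniformFirstOrder_one hR.uniformFirstOrder_u (by norm_num) (by norm_num)
      (fun α _ => (mul_one _).symm) (fun α _ => ?_) (fun α _ => ?_) (fun α hα => (hdet α hα).1)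
      (fun α hα => (hdet α hα).2.1) (fun α hα => (hdet α hα).2.2.1)
      (fun α hα => (hdet α hα).2.2.2))
  · rw [cMonomial, cMonomial, single_mul_single, one_mul, show (-1 : ℚ) + (1 - α) = -α by ring]
  · rw [cMonomial, single_mul_single, neg_add_cancel, mul_inv_cancel₀ hδt]
    rfl

/-- The scale is `s = t`, with `b = 1` and `a = u = c / t`. -/
theorem exists_coefficients_of_one_lt (δ δt : K) (hδt : δt ≠ 0) :
    ∃ (p : ℕ → K[X]) (q : K[X]), ∀ α ∈ Set.Ioi (1 : ℚ), ∀ a : ℚ, 0 ≤ a →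
      (∀ i : ℕ, a = α - i * (α - 1) → puiseuxCoeff δ δt α a = p i + if a = 0 then q else 0) ∧
      ((∀ i : ℕ, a ≠ α - i * (α - 1)) → puiseuxCoeff δ δt α a = if a = 0 then q else 0) := by
  have hpos : ∀ α ∈ Set.Ioi (1 : ℚ), 0 < α := fun α hα => zero_lt_one.trans hα
  have hR : IsRegime (K := K) (Set.Ioi (1 : ℚ)) (fun α => single (α - 1) δt⁻¹)
      (fun α => single α δt⁻¹) :=
    ⟨hpos, fun α hα => lt_orderTop_single (sub_pos.mpr hα),
      fun α _ => by rw [addVal_apply]; exact orderTop_single_le⟩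
  have hdet := fun α (hα : α ∈ Set.Ioi (1 : ℚ)) => det_wordGram_cMonomial hδt (hpos α hα)
    (ne_of_gt hα)
  refine exists_uniform_coefficients δ δt (fun α hα => sub_pos.mpr hα)
    (exists_firstOrder_logBlock hR δ δt hδt (s := fun α => cMonomial δt α)
      hR.uniformFirstOrder_u uniformFirstOrder_one (by norm_num) (by norm_num)
      (fun α _ => ?_) (fun α _ => (mul_one _).symm) (fun α _ => ?_) (fun α hα => (hdet α hα).1)
      (fun α hα => (hdet α hα).2.1) (fun α hα => (hdet α hα).2.2.1)
      (fun α hα => (hdet α hα).2.2.2))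
  · rw [cMonomial, cMonomial, single_mul_single, mul_inv_cancel₀ hδt,
      show -α + (α - 1) = (-1 : ℚ) by ring]
  · rw [cMonomial, single_mul_single, neg_add_cancel, mul_inv_cancel₀ hδt]
    rfl

end Extraction

/-! ### Assembling the principal part. -/

section PrincipalPart

variable {K : Type*} [Field K] [CharZero K]

/-- The principal part, when the positive exponents are `α - i θ` for `i < n`. -/
theorem prinPart_eq {δ δt : K} {α θ : ℚ} (hθ : 0 < θ) {p : ℕ → K[X]} {q : K[X]} {n : ℕ}
    (hp : ∀ a : ℚ, 0 ≤ a →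
      (∀ i : ℕ, a = α - i * θ → puiseuxCoeff δ δt α a = p i + if a = 0 then q else 0) ∧
      ((∀ i : ℕ, a ≠ α - i * θ) → puiseuxCoeff δ δt α a = if a = 0 then q else 0))
    (hpos : ∀ i < n, 0 < α - i * θ) (hneg : α - n * θ ≤ 0) :
    prinPart δ δt α = ∑ i ∈ Finset.range n, Pi.single (α - i * θ) (p i)
      + Pi.single 0 (puiseuxCoeff δ δt α 0) := by
  funext a
  rw [Pi.add_apply, Finset.sum_apply, prinPart]
  rcases lt_trichotomy a 0 with ha | rfl | ha
  · rw [if_neg ha.not_ge, Pi.single_eq_of_ne ha.ne, Finset.sum_eq_zero, add_zero]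
    intro i hi
    exact Pi.single_eq_of_ne (ha.trans (hpos i (Finset.mem_range.mp hi))).ne _
  · rw [if_pos le_rfl, Pi.single_eq_same, Finset.sum_eq_zero, zero_add]
    intro i hi
    exact Pi.single_eq_of_ne (hpos i (Finset.mem_range.mp hi)).ne _
  · rw [if_pos ha.le, Pi.single_eq_of_ne ha.ne', add_zero]
    by_cases h : ∃ i : ℕ, a = α - i * θ
    · obtain ⟨i, hi⟩ := h
      -- As `hneg` allows equality, an exponent `α - n * θ = 0` belongs to the constant term and not
      -- to the sum.
      have hin : i < n := by
        by_contra hni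
        have : (n : ℚ) * θ ≤ i * θ := by
          gcongr
          exact_mod_cast not_lt.mp hni
        linarith
      rw [(hp a ha.le).1 i hi, if_neg ha.ne', add_zero, Finset.sum_eq_single i, hi,
        Pi.single_eq_same]
      · intro j _ hj
        refine Pi.single_eq_of_ne (fun h => hj ?_) _
        have : (i : ℚ) * θ = j * θ := by linarith
        exact_mod_cast (mul_right_cancel₀ hθ.ne' this).symm
      · exact fun h => absurd (Finset.mem_range.mpr hin) h
    · push Not at h
      rw [(hp a ha.le).2 h, if_neg ha.ne', Finset.sum_eq_zero]
      intro i _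
      exact Pi.single_eq_of_ne (h i) _

end PrincipalPart

theorem Finset.sum_Icc_two_eq_sum_range {M : Type*} [AddCommMonoid M] (f : ℕ → M) (n : ℕ) :
    ∑ m ∈ Finset.Icc 2 (n + 1), f m = ∑ i ∈ Finset.range n, f (i + 2) := by
  induction n with
  | zero => simp
  | succ n ih => rw [Finset.sum_Icc_succ_top (by lia), ih, Finset.sum_range_succ]

/-! ### Proper and improper fractions. -/

section Proportions

variable {K : Type*} [Field K] [CharZero K]

theorem properFractions (δ δt : K) (hδt : δt ≠ 0) :
    ∃ fMinus : K[X],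
      (∀ β : ℚ, β ∈ Set.Ioo (0 : ℚ) 1 → IsRegularExponent β → puiseuxCoeff δ δt β 0 = fMinus) ∧
      (∀ M : ℕ, 2 ≤ M → ∀ α : ℚ, α ∈ Set.Ioc (((M : ℚ) - 1) / M) ((M : ℚ) / (M + 1)) →
        puiseuxCoeff δ δt α (M * α - (M - 1))
          = puiseuxCoeff δ δt (((M : ℚ) - 1) / M) 0 - fMinus) ∧
      (∀ M : ℕ, 1 ≤ M → ∀ α : ℚ, α ∈ Set.Ioc (((M : ℚ) - 1) / M) ((M : ℚ) / (M + 1)) →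
        ∀ α₁ : ℚ, α₁ ∈ Set.Ioo (0 : ℚ) (1 / 2) →
          prinPart δ δt α =
            Pi.single α (puiseuxCoeff δ δt α₁ α₁)
              + ∑ m ∈ Finset.Icc 2 M,
                  Pi.single ((m : ℚ) * α - (m - 1))
                    (puiseuxCoeff δ δt (((m : ℚ) - 1) / m) 0 - fMinus)
              + Pi.single 0 (puiseuxCoeff δ δt α 0)) := by
  obtain ⟨p, q, hpq⟩ := exists_coefficients_of_lt_one δ δt hδt
  -- the exceptional constant terms
  have hexc : ∀ i : ℕ, puiseuxCoeff δ δt ((((i + 2 : ℕ) : ℚ) - 1) / ((i + 2 : ℕ) : ℚ)) 0 - q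
      = p (i + 1) := by
    intro i
    have hi : (0 : ℚ) < (i : ℚ) + 2 := by positivity
    rw [(hpq ((((i + 2 : ℕ) : ℚ) - 1) / ((i + 2 : ℕ) : ℚ)) ⟨?_, ?_⟩ 0 le_rfl).1 (i + 1) ?_,
      if_pos rfl, add_sub_cancel_right]
    · push_cast
      exact div_pos (by linarith) hi
    · push_cast
      rw [div_lt_one hi]
      linarith
    · push_cast
      field_simp
      ring
  -- The interval is the condition that exactly the `M` exponents `α - i (1 - α)` with `i < M` are
  -- positive.
  have hmem : ∀ (M : ℕ), 1 ≤ M → ∀ α : ℚ,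
      α ∈ Set.Ioc (((M : ℚ) - 1) / M) ((M : ℚ) / (M + 1)) →
      α ∈ Set.Ioo (0 : ℚ) 1 ∧ 0 < α - ((M : ℚ) - 1) * (1 - α) ∧ α - M * (1 - α) ≤ 0 := by
    intro M hM α hα
    have hM' : (1 : ℚ) ≤ M := by exact_mod_cast hM
    obtain ⟨h1, h2⟩ := hα
    rw [div_lt_iff₀ (by linarith)] at h1
    rw [le_div_iff₀ (by linarith)] at h2
    refine ⟨⟨?_, ?_⟩, by linarith, by linarith⟩
    · by_contra h
      nlinarith
    · by_contra h
      nlinarith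
  refine ⟨q, fun β hβ hreg => ?_, fun M hM α hα => ?_, fun M hM α hα α₁ hα₁ => ?_⟩
  · rw [(hpq β hβ 0 le_rfl).2, if_pos rfl]
    intro i hi
    refine hreg.2.2 (Or.inl ⟨i, ?_, ?_⟩)
    · rcases Nat.eq_zero_or_pos i with rfl | h
      · simp at hi
        linarith [hβ.1]
      · exact h
    · rw [eq_div_iff (by positivity)]
      linarith
  · obtain ⟨k, rfl⟩ := Nat.exists_eq_add_of_le' hM
    obtain ⟨h1, h2, h3⟩ := hmem _ (by lia) α hα
    have ha : ((k + 2 : ℕ) : ℚ) * α - (((k + 2 : ℕ) : ℚ) - 1) = α - ((k + 1 : ℕ) : ℚ) * (1 - α) := by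
      push_cast
      ring
    have hpos : 0 < ((k + 2 : ℕ) : ℚ) * α - (((k + 2 : ℕ) : ℚ) - 1) := by linarith
    rw [(hpq α h1 _ hpos.le).1 (k + 1) ha, if_neg hpos.ne', add_zero, hexc]
  · obtain ⟨k, rfl⟩ := Nat.exists_eq_add_of_le' hM
    obtain ⟨h1, h2, h3⟩ := hmem _ hM α hα
    have hα₁' : α₁ ∈ Set.Ioo (0 : ℚ) 1 := ⟨hα₁.1, by linarith [hα₁.2]⟩
    rw [prinPart_eq (n := k + 1) (sub_pos.mpr h1.2) (hpq α h1) (fun i hi => ?_) h3,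
      Finset.sum_range_succ', Finset.sum_Icc_two_eq_sum_range,
      (hpq α₁ hα₁' α₁ hα₁.1.le).1 0 (by simp), if_neg hα₁.1.ne', add_zero, add_comm (Finset.sum _ _)]
    · congr 2
      · simp
      · refine Finset.sum_congr rfl fun i _ => ?_
        rw [hexc]
        congr 1
        push_cast
        ring
    · have hle : (i : ℚ) ≤ k := by exact_mod_cast Nat.lt_succ_iff.mp hi
      have : (i : ℚ) * (1 - α) ≤ k * (1 - α) :=
        mul_le_mul_of_nonneg_right hle (sub_pos.mpr h1.2).le
      push_cast at h2
      linarith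

theorem improperFractions (δ δt : K) (hδt : δt ≠ 0) :
    ∃ fPlus : K[X],
      (∀ β : ℚ, 1 < β → IsRegularExponent β → puiseuxCoeff δ δt β 0 = fPlus) ∧
      (∀ N : ℕ, 2 ≤ N → ∀ α : ℚ, α ∈ Set.Ico (((N : ℚ) + 1) / N) ((N : ℚ) / (N - 1)) →
        puiseuxCoeff δ δt α (N - (N - 1) * α)
          = puiseuxCoeff δ δt ((N : ℚ) / (N - 1)) 0 - fPlus) ∧
      (∀ N : ℕ, 1 ≤ N → ∀ α : ℚ, ((N : ℚ) + 1) / N ≤ α → ((N : ℚ) - 1) * α < N →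
        ∀ α₁ : ℚ, 2 < α₁ →
          prinPart δ δt α =
            Pi.single α (puiseuxCoeff δ δt α₁ α₁)
              + Pi.single 1 (puiseuxCoeff δ δt α₁ 1)
              + ∑ n ∈ Finset.Icc 2 N,
                  Pi.single ((n : ℚ) - (n - 1) * α)
                    (puiseuxCoeff δ δt ((n : ℚ) / (n - 1)) 0 - fPlus)
              + Pi.single 0 (puiseuxCoeff δ δt α 0)) := by
  obtain ⟨p, q, hpq⟩ := exists_coefficients_of_one_lt δ δt hδt
  have hexc : ∀ i : ℕ, puiseuxCoeff δ δt (((i + 2 : ℕ) : ℚ) / (((i + 2 : ℕ) : ℚ) - 1)) 0 - q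
      = p (i + 2) := by
    intro i
    have hi : (0 : ℚ) < (i : ℚ) + 1 := by positivity
    have hi' : (i : ℚ) + 2 - 1 = i + 1 := by ring
    rw [(hpq (((i + 2 : ℕ) : ℚ) / (((i + 2 : ℕ) : ℚ) - 1)) ?_ 0 le_rfl).1 (i + 2) ?_,
      if_pos rfl, add_sub_cancel_right]
    · push_cast
      rw [hi', Set.mem_Ioi, one_lt_div hi]
      linarith
    · push_cast
      rw [hi']
      field_simp
      ring
  -- The positive exponents are now those with `i ≤ N`, one more than before because `i = 1` always
  -- gives the power `c`. The upper bound is multiplied out so that it is vacuous for `N = 1`.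
  have hmem : ∀ (N : ℕ), 1 ≤ N → ∀ α : ℚ, ((N : ℚ) + 1) / N ≤ α → ((N : ℚ) - 1) * α < N →
      α ∈ Set.Ioi (1 : ℚ) ∧ 0 < α - (N : ℚ) * (α - 1) ∧ α - ((N : ℚ) + 1) * (α - 1) ≤ 0 := by
    intro N hN α h1 h2
    have hN' : (1 : ℚ) ≤ N := by exact_mod_cast hN
    rw [div_le_iff₀ (by linarith)] at h1
    refine ⟨?_, by linarith, by linarith⟩
    rw [Set.mem_Ioi]
    by_contra h
    nlinarith
  refine ⟨q, fun β hβ hreg => ?_, fun N hN α hα => ?_, fun N hN α h1 h2 α₁ hα₁ => ?_⟩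
  · rw [(hpq β hβ 0 le_rfl).2, if_pos rfl]
    intro i hi
    -- The exponents for `i = 0` and `i = 1` are `β` and `1`, which never vanish.
    have hi1 : 2 ≤ i := by
      by_contra h
      have : i = 0 ∨ i = 1 := by lia
      rcases this with rfl | rfl
      · simp at hi
        linarith
      · simp at hi
    obtain ⟨k, rfl⟩ := Nat.exists_eq_add_of_le' hi1
    refine hreg.2.2 (Or.inr ⟨k + 1, by lia, ?_⟩)
    rw [eq_div_iff (by positivity)]
    push_cast at hi ⊢
    linarith
  · obtain ⟨k, rfl⟩ := Nat.exists_eq_add_of_le' hN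
    have hk : (0 : ℚ) < ((k + 2 : ℕ) : ℚ) - 1 := by
      push_cast
      linarith [(Nat.cast_nonneg k : (0 : ℚ) ≤ k)]
    obtain ⟨h1, h2, h3⟩ := hmem _ (by lia) α hα.1 (by
      have := (lt_div_iff₀ hk).mp hα.2
      linarith)
    have ha : ((k + 2 : ℕ) : ℚ) - (((k + 2 : ℕ) : ℚ) - 1) * α = α - ((k + 2 : ℕ) : ℚ) * (α - 1) := by
      ring
    have hpos : 0 < ((k + 2 : ℕ) : ℚ) - (((k + 2 : ℕ) : ℚ) - 1) * α := by linarith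
    rw [(hpq α h1 _ hpos.le).1 (k + 2) ha, if_neg hpos.ne', add_zero, hexc]
  · obtain ⟨k, rfl⟩ := Nat.exists_eq_add_of_le' hN
    obtain ⟨h1, h2, h3⟩ := hmem _ hN α h1 h2
    have hα₁' : α₁ ∈ Set.Ioi (1 : ℚ) := by
      rw [Set.mem_Ioi]
      linarith
    have hα₁0 : α₁ ≠ 0 := by linarith
    rw [prinPart_eq (n := k + 2) (sub_pos.mpr h1) (hpq α h1) (fun i hi => ?_)
        (by push_cast at h3 ⊢; linarith),
      Finset.sum_range_succ', Finset.sum_range_succ', Finset.sum_Icc_two_eq_sum_range,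
      (hpq α₁ hα₁' α₁ (by linarith)).1 0 (by simp), if_neg hα₁0, add_zero,
      (hpq α₁ hα₁' 1 zero_le_one).1 1 (by simp), if_neg one_ne_zero, add_zero]
    · have e0 : α - ((0 : ℕ) : ℚ) * (α - 1) = α := by simp
      have e1 : α - ((0 + 1 : ℕ) : ℚ) * (α - 1) = 1 := by push_cast; ring
      have es : ∑ i ∈ Finset.range k, (Pi.single (α - ((i + 1 + 1 : ℕ) : ℚ) * (α - 1)) (p (i + 1 + 1)) :
          ℚ → K[X]) = ∑ i ∈ Finset.range k, Pi.single (((i + 2 : ℕ) : ℚ) - (((i + 2 : ℕ) : ℚ) - 1) * α)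
            (puiseuxCoeff δ δt (((i + 2 : ℕ) : ℚ) / (((i + 2 : ℕ) : ℚ) - 1)) 0 - q) := by
        refine Finset.sum_congr rfl fun i _ => ?_
        rw [hexc]
        congr 1
        push_cast
        ring
      rw [es, e0, e1]
      abel
    · have hle : (i : ℚ) ≤ (k + 1 : ℕ) := by exact_mod_cast Nat.lt_succ_iff.mp hi
      have : (i : ℚ) * (α - 1) ≤ (k + 1 : ℕ) * (α - 1) :=
        mul_le_mul_of_nonneg_right hle (sub_pos.mpr h1).le
      linarith

end Proportions

end

theorem proposition3 {K : Type*} [Field K] [CharZero K] (δ δt : K) (hδt : δt ≠ 0) :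
    -- the block coefficients are well defined up to the considered order
    (∀ α : ℚ, 0 < α → α ≠ 1 → ∀ n : ℕ, n ≤ 5 →
      IsUnit (gramMatrix (cMonomial (1 : K) 1) (cMonomial δt α) n).det) ∧
    -- proper fractions
    (∃ fMinus : K[X],
      (∀ β : ℚ, β ∈ Set.Ioo (0 : ℚ) 1 → IsRegularExponent β → puiseuxCoeff δ δt β 0 = fMinus) ∧
      (∀ M : ℕ, 2 ≤ M → ∀ α : ℚ, α ∈ Set.Ioc (((M : ℚ) - 1) / M) ((M : ℚ) / (M + 1)) →
        puiseuxCoeff δ δt α (M * α - (M - 1))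
          = puiseuxCoeff δ δt (((M : ℚ) - 1) / M) 0 - fMinus) ∧
      (∀ M : ℕ, 1 ≤ M → ∀ α : ℚ, α ∈ Set.Ioc (((M : ℚ) - 1) / M) ((M : ℚ) / (M + 1)) →
        ∀ α₁ : ℚ, α₁ ∈ Set.Ioo (0 : ℚ) (1 / 2) →
          prinPart δ δt α =
            Pi.single α (puiseuxCoeff δ δt α₁ α₁)
              + ∑ m ∈ Finset.Icc 2 M,
                  Pi.single ((m : ℚ) * α - (m - 1))
                    (puiseuxCoeff δ δt (((m : ℚ) - 1) / m) 0 - fMinus)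
              + Pi.single 0 (puiseuxCoeff δ δt α 0))) ∧
    -- improper fractions
    (∃ fPlus : K[X],
      (∀ β : ℚ, 1 < β → IsRegularExponent β → puiseuxCoeff δ δt β 0 = fPlus) ∧
      (∀ N : ℕ, 2 ≤ N → ∀ α : ℚ, α ∈ Set.Ico (((N : ℚ) + 1) / N) ((N : ℚ) / (N - 1)) →
        puiseuxCoeff δ δt α (N - (N - 1) * α)
          = puiseuxCoeff δ δt ((N : ℚ) / (N - 1)) 0 - fPlus) ∧
      (∀ N : ℕ, 1 ≤ N → ∀ α : ℚ, ((N : ℚ) + 1) / N ≤ α → ((N : ℚ) - 1) * α < N →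
        ∀ α₁ : ℚ, 2 < α₁ →
          prinPart δ δt α =
            Pi.single α (puiseuxCoeff δ δt α₁ α₁)
              + Pi.single 1 (puiseuxCoeff δ δt α₁ 1)
              + ∑ n ∈ Finset.Icc 2 N,
                  Pi.single ((n : ℚ) - (n - 1) * α)
                    (puiseuxCoeff δ δt ((n : ℚ) / (n - 1)) 0 - fPlus)
              + Pi.single 0 (puiseuxCoeff δ δt α 0))) := by
  exact ⟨fun α h0 h1 n hn => isUnit_det_gramMatrix_cMonomial hδt h0 h1 hn, properFractions δ δt hδt,
    improperFractions δ δt hδt⟩
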